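/- For i.i.d. real random variables $X_1,X_2,\dots$ put $S_n=X_1+\cdots+X_n$, $S_n^{(2)}=S_1+\cdots+S_n$ and $p_n^{(2)}=\mathbb P\big(\max_{1\le k\le n}S_k^{(2)}<0\big)$. Write $a_n\asymp b_n$ if there are constants $C_1,C_2>0$ with $C_1a_n\le b_n\le C_2a_n$ for all $n\ge 1$. (a) For every $0<\gamma<1/4$ there is an integrable, zero-mean random variable $X_1$ such that, for i.i.d. copies $X_1,X_2,\dots$ of it, $p_n^{(2)}\asymp n^{-\gamma}$. (b) Explicitly, let $1<\alpha<2$, let $Y_1,Y_2,\dots$ be i.i.d. with $\mathbb P(Y_1>y)=y^{-\alpha}$ for all $y\ge 1$, and let $X_i=Y_i-\mathbb E Y_1$. Then $Y_1$ and $X_1$ are integrable, $\mathbb E X_1=0$, the sequence $n^{-1/\alpha}\,\mathbb E|S_n|$ converges to a finite and strictly positive limit as $n\to\infty$, $\mathbb E|S_n|\asymp n^{1/\alpha}$, and $$p_n^{(2)}\asymp n^{-\gamma}\qquad\text{with}\qquad \gamma=\tfrac12\Big(1-\tfrac1\alpha\Big).$$ -/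

import Mathlib

open MeasureTheory ProbabilityTheory Filter Topology

/-- A sequence of (real) i.i.d. random variables on `(Ω, P)`.
The variable `X i` plays the role of the `(i+1)`-st variable of the sequence `X₁, X₂, …`. -/
structure IsIIDSeq {Ω : Type*} [MeasurableSpace Ω] (P : Measure Ω) (X : ℕ → Ω → ℝ) : Prop where
  measurable : ∀ i, Measurable (X i)
  indep : iIndepFun X P
  identDistrib : ∀ i, IdentDistrib (X i) (X 0) P P

/-- The partial sum `S_n` of the first `n` variables. -/
def partialSum {Ω : Type*} (X : ℕ → Ω → ℝ) (n : ℕ) (ω : Ω) : ℝ :=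
  ∑ i ∈ Finset.range n, X i ω

/-- The iterated partial sum `S_n^{(2)} = S_1 + ⋯ + S_n`. -/
def iteratedSum {Ω : Type*} (X : ℕ → Ω → ℝ) (n : ℕ) (ω : Ω) : ℝ :=
  ∑ k ∈ Finset.Icc 1 n, partialSum X k ω

/-- The persistence probability `p_n^{(2)} = P (max_{1 ≤ k ≤ n} S_k^{(2)} < 0)`. -/
noncomputable def persistenceProb {Ω : Type*} [MeasurableSpace Ω] (P : Measure Ω)
    (X : ℕ → Ω → ℝ) (n : ℕ) : ℝ :=
  P.real {ω | ∀ k ∈ Finset.Icc 1 n, iteratedSum X k ω < 0}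

/-- `a_n ≍ b_n`: the two sequences are comparable, up to positive constant factors,
for all `n ≥ 1`. -/
def SameOrder (a b : ℕ → ℝ) : Prop :=
  ∃ C₁ > 0, ∃ C₂ > 0, ∀ n : ℕ, 1 ≤ n → C₁ * a n ≤ b n ∧ b n ≤ C₂ * a n

/-!
For a slope `t`, let `k` be the first argmax of `j ↦ S_j^{(2)} - t j` on `{0, …, a + b}`. The
increments after `k` must stay below, and those before `k`, read backwards, must stay below too:
after a shift and a time reversal these are two independent persistence events. Conversely, when
the persistence events occur, every slope in `[S_{k+1}, S_k)` has its peak at `k`, and this interval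
has length `X_{k+1}⁻`. Integrating over `t` and taking expectations compares the convolution
`∑ p_a p_b` of persistence probabilities with `𝔼|S_n|`, and monotonicity of `p` turns regular growth
`𝔼|S_n| ≍ n ^ b` into `p_n ≍ n ^ (-(1 - b) / 2)`. When `φ(t) = 1 + c t ^ α + o(t ^ α)` as `t ↓ 0`,
the formula `𝔼|S_n| · ∫ (1 - cos u) / u² = ∫ (1 - Re φ(t) ^ n) / t²` gives
`𝔼|S_n| ~ C n ^ (1 / α)` by dominated convergence.
-/

/-! ### Iterated sums of a real sequence -/

section Sequences

variable {x y : ℕ → ℝ} {δ : ℝ} {m n r : ℕ}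

/-- The partial sums of a real sequence; `psum x n` is the sum of the first `n` terms. -/
def psum (x : ℕ → ℝ) (n : ℕ) : ℝ := ∑ i ∈ Finset.range n, x i

/-- The iterated partial sums `psum x 1 + ⋯ + psum x n` of a real sequence. -/
def isum (x : ℕ → ℝ) (n : ℕ) : ℝ := ∑ k ∈ Finset.Icc 1 n, psum x k

@[simp] lemma psum_zero (x : ℕ → ℝ) : psum x 0 = 0 := Finset.sum_range_zero x

lemma psum_succ (x : ℕ → ℝ) (n : ℕ) : psum x (n + 1) = psum x n + x n :=
  Finset.sum_range_succ x n

@[simp] lemma psum_one (x : ℕ → ℝ) : psum x 1 = x 0 := Finset.sum_range_one x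

@[simp] lemma isum_zero (x : ℕ → ℝ) : isum x 0 = 0 := rfl

lemma isum_succ (x : ℕ → ℝ) (n : ℕ) : isum x (n + 1) = isum x n + psum x (n + 1) :=
  Finset.sum_Icc_succ_top n.succ_pos _

lemma psum_congr (h : ∀ i < n, x i = y i) : psum x n = psum y n :=
  Finset.sum_congr rfl fun i hi => h i (Finset.mem_range.1 hi)

lemma isum_congr (h : ∀ i < n, x i = y i) : isum x n = isum y n :=
  Finset.sum_congr rfl fun _ hk => psum_congr fun i hi =>
    h i (hi.trans_le (Finset.mem_Icc.1 hk).2)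

/-- The sequence with its first `a` terms removed. -/
def shiftSeq (a : ℕ) (x : ℕ → ℝ) : ℕ → ℝ := fun l => x (a + l)

/-- The permutation of `ℕ` that reverses `{0, …, a}` and fixes the other indices. -/
def revIdx (a l : ℕ) : ℕ := if l ≤ a then a - l else l

/-- The sequence with its first `a + 1` terms reversed. -/
def revSeq (a : ℕ) (x : ℕ → ℝ) : ℕ → ℝ := fun l => x (revIdx a l)

lemma revIdx_of_le {a l : ℕ} (h : l ≤ a) : revIdx a l = a - l := if_pos h

lemma revIdx_injective (a : ℕ) : Function.Injective (revIdx a) := by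
  intro k l h
  unfold revIdx at h
  split_ifs at h <;> omega

lemma psum_add (x : ℕ → ℝ) (a j : ℕ) : psum x (a + j) = psum x a + psum (shiftSeq a x) j :=
  Finset.sum_range_add x a j

lemma isum_add (x : ℕ → ℝ) (a j : ℕ) :
    isum x (a + j) = isum x a + j * psum x a + isum (shiftSeq a x) j := by
  induction j with
  | zero => simp
  | succ j ih =>
    rw [← add_assoc, isum_succ, isum_succ, ih, add_assoc a j 1, psum_add]
    push_cast
    ring

lemma psum_revSeq (x : ℕ → ℝ) {a j : ℕ} (h : j ≤ a + 1) :
    psum (revSeq a x) j = psum x (a + 1) - psum x (a + 1 - j) := by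
  induction j with
  | zero => simp
  | succ j ih =>
    have hlast : revSeq a x j = x (a - j) := congrArg x (revIdx_of_le (by omega))
    have hsucc := psum_succ x (a - j)
    rw [psum_succ, ih (by omega), hlast, Nat.add_sub_add_right]
    rw [show a - j + 1 = a + 1 - j by omega] at hsucc
    linarith

lemma isum_revSeq (x : ℕ → ℝ) {a i : ℕ} (h : i ≤ a) :
    isum (revSeq a x) i = isum x (a - i) + (i + 1) * psum x (a + 1) - isum x (a + 1) := by
  induction i with
  | zero => simp [isum_succ]
  | succ i ih =>
    have hsucc := isum_succ x (a - (i + 1))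
    rw [show a - (i + 1) + 1 = a - i by omega] at hsucc
    rw [isum_succ, ih (by omega), psum_revSeq x (by omega), Nat.add_sub_add_right, hsucc]
    push_cast
    ring

lemma abs_isum_sub_le (x : ℕ → ℝ) {a b N : ℕ} (hab : a ≤ b) (hb : b ≤ N) :
    |isum x b - isum x a| ≤ ∑ j ∈ Finset.range (N + 1), |psum x j| := by
  have hsum : isum x b - isum x a = ∑ j ∈ Finset.Ioc a b, psum x j := by
    induction b, hab using Nat.le_induction with
    | base => simp
    | succ b hab ih =>
      rw [Finset.sum_Ioc_succ_top hab, ← ih (by omega), isum_succ]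
      ring
  rw [hsum]
  refine (Finset.abs_sum_le_sum_abs _ _).trans
    (Finset.sum_le_sum_of_subset_of_nonneg (fun j hj => ?_) fun _ _ _ => abs_nonneg _)
  simp only [Finset.mem_Ioc, Finset.mem_range] at *
  omega

lemma psum_le_of_forall_le (hx : ∀ i < r, x i ≤ -δ) {k : ℕ} (hk : k ≤ r) :
    psum x k ≤ -(k * δ) := by
  calc psum x k ≤ ∑ _i ∈ Finset.range k, -δ :=
        Finset.sum_le_sum fun i hi => hx i ((Finset.mem_range.1 hi).trans_le hk)
    _ = -(k * δ) := by simp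

lemma isum_le_of_forall_le (hδ : 0 ≤ δ) (hx : ∀ i < r, x i ≤ -δ) {k : ℕ} (hk : k ≤ r) :
    isum x k ≤ -(k * δ) := by
  induction k with
  | zero => simp
  | succ k ih =>
    have hkδ : 0 ≤ k * δ := by positivity
    rw [isum_succ]
    linarith [ih (by omega), psum_le_of_forall_le hx hk]

/-- The iterated sums of positive index up to `m` are negative. -/
def NegUpTo (m : ℕ) (x : ℕ → ℝ) : Prop := ∀ j ∈ Finset.Icc 1 m, isum x j < 0

/-- The iterated sums up to index `m` stay below the line `j ↦ B * (j + 1)`: the persistence event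
`NegUpTo` relaxed so that it also covers what happens next to a jump of size `B`. -/
def BelowUpTo (B : ℝ) (m : ℕ) (x : ℕ → ℝ) : Prop := ∀ j ≤ m, isum x j ≤ B * (j + 1)

lemma NegUpTo.mono (hmn : m ≤ n) (h : NegUpTo n x) : NegUpTo m x :=
  fun j hj => h j (Finset.Icc_subset_Icc_right hmn hj)

lemma NegUpTo.isum_nonpos (h : NegUpTo m x) {i : ℕ} (hi : i ≤ m) : isum x i ≤ 0 := by
  rcases i.eq_zero_or_pos with rfl | hpos
  · simp
  · exact (h i (Finset.mem_Icc.2 ⟨hpos, hi⟩)).le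

lemma negUpTo_of_belowUpTo {B : ℝ} (hB : B < r * δ) (hx : ∀ i < r, x i ≤ -δ)
    (h : BelowUpTo B m (shiftSeq r x)) : NegUpTo m x := by
  have hB0 : 0 ≤ B := by simpa using h 0 m.zero_le
  have hδ : 0 < δ := pos_of_mul_pos_right (hB0.trans_lt hB) r.cast_nonneg
  intro j hj
  obtain ⟨hj1, hjm⟩ := Finset.mem_Icc.1 hj
  rcases le_total j r with hjr | hrj
  · have hpos : 0 < j * δ := mul_pos (by exact_mod_cast hj1) hδ
    linarith [isum_le_of_forall_le hδ.le hx hjr]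
  · obtain ⟨i, rfl⟩ := Nat.exists_eq_add_of_le hrj
    calc isum x (r + i) = isum x r + i * psum x r + isum (shiftSeq r x) i := isum_add x r i
      _ ≤ -(r * δ) + i * -(r * δ) + B * (i + 1) := by
        gcongr
        · exact isum_le_of_forall_le hδ.le hx le_rfl
        · exact psum_le_of_forall_le hx le_rfl
        · exact h i (by omega)
      _ = -((i + 1) * (r * δ - B)) := by ring
      _ < 0 := neg_neg_of_pos (mul_pos (by positivity) (sub_pos.2 hB))

end Sequences

section FirstMax

variable {β : Type*} [LinearOrder β] {f : ℕ → β} {N k l : ℕ}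

/-- `k` is the first index at which `f` attains its maximum over `{0, …, N}`. -/
structure IsFirstMax (f : ℕ → β) (N k : ℕ) : Prop where
  le : k ≤ N
  lt_of_lt : ∀ j < k, f j < f k
  le_of_le : ∀ j ≤ N, f j ≤ f k

lemma exists_isFirstMax (f : ℕ → β) (N : ℕ) : ∃ k, IsFirstMax f N k := by
  classical
  have hex : ∃ k, k ≤ N ∧ ∀ j ≤ N, f j ≤ f k := by
    obtain ⟨k, hk, hmax⟩ := Finset.exists_max_image (Finset.range (N + 1)) f ⟨0, by simp⟩
    exact ⟨k, Finset.mem_range_succ_iff.1 hk, fun j hj => hmax j (Finset.mem_range_succ_iff.2 hj)⟩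
  obtain ⟨hle, hmax⟩ := Nat.find_spec hex
  refine ⟨Nat.find hex, hle, fun j hj => lt_of_not_ge fun hge => Nat.find_min hex hj ?_, hmax⟩
  exact ⟨hj.le.trans hle, fun i hi => (hmax i hi).trans hge⟩

lemma IsFirstMax.unique (hk : IsFirstMax f N k) (hl : IsFirstMax f N l) : k = l := by
  rcases lt_trichotomy k l with h | h | h
  · exact absurd (hl.lt_of_lt k h) (hk.le_of_le l hl.le).not_gt
  · exact h
  · exact absurd (hk.lt_of_lt l h) (hl.le_of_le k hk.le).not_gt

lemma isFirstMax_iff_left_right {a b : ℕ} : IsFirstMax f (a + b + 2) (a + 1) ↔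
    (∀ i ≤ a, f (a - i) < f (a + 1)) ∧ ∀ i ≤ b, f (a + 2 + i) ≤ f (a + 1) := by
  constructor
  · exact fun h => ⟨fun i _ => h.lt_of_lt _ (by omega), fun i _ => h.le_of_le _ (by omega)⟩
  · rintro ⟨hleft, hright⟩
    have hlt (j : ℕ) (hj : j < a + 1) : f j < f (a + 1) := by
      simpa only [Nat.sub_sub_self (Nat.lt_succ_iff.1 hj)] using hleft (a - j) (a.sub_le j)
    refine ⟨by omega, hlt, fun j hj => ?_⟩
    rcases lt_trichotomy j (a + 1) with h | rfl | h
    · exact (hlt j h).le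
    · exact le_rfl
    · obtain ⟨i, rfl⟩ := Nat.exists_eq_add_of_le (show a + 2 ≤ j from h)
      exact hright i (by omega)

end FirstMax

/-! ### Peaks of the iterated sums along a slope -/

section Peaks

variable {x : ℕ → ℝ} {t B : ℝ} {a b : ℕ}

/-- The iterated sums of `x` seen from the line of slope `t` through the origin. -/
def drift (x : ℕ → ℝ) (t : ℝ) (j : ℕ) : ℝ := isum x j - t * j

lemma drift_succ (x : ℕ → ℝ) (t : ℝ) (j : ℕ) :
    drift x t (j + 1) = drift x t j + (psum x (j + 1) - t) := by
  simp only [drift, isum_succ]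
  push_cast
  ring

lemma isFirstMax_drift_iff : IsFirstMax (drift x t) (a + b + 2) (a + 1) ↔
    (∀ i ≤ a, isum (revSeq a x) i < (i + 1) * (psum x (a + 1) - t)) ∧
      ∀ i ≤ b, isum (shiftSeq (a + 2) x) i ≤ (i + 1) * (t - psum x (a + 2)) := by
  have hleft (i : ℕ) (hi : i ≤ a) : drift x t (a - i) < drift x t (a + 1) ↔
      isum (revSeq a x) i < (i + 1) * (psum x (a + 1) - t) := by
    rw [isum_revSeq x hi, ← sub_pos, ← sub_pos (b := _ + _ - _)]
    simp only [drift, Nat.cast_sub hi]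
    push_cast
    ring_nf
  have hright (i : ℕ) : drift x t (a + 2 + i) ≤ drift x t (a + 1) ↔
      isum (shiftSeq (a + 2) x) i ≤ (i + 1) * (t - psum x (a + 2)) := by
    simp only [drift, isum_add x (a + 2), isum_succ x (a + 1)]
    push_cast
    constructor <;> intro h <;> linarith
  rw [isFirstMax_iff_left_right]
  exact and_congr (forall₂_congr hleft) (forall₂_congr fun i _ => hright i)

lemma isFirstMax_drift_of_negUpTo (hL : NegUpTo a (revSeq a x))
    (hR : NegUpTo b (shiftSeq (a + 2) x))
    (ht : t ∈ Set.Ico (psum x (a + 2)) (psum x (a + 1))) :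
    IsFirstMax (drift x t) (a + b + 2) (a + 1) := by
  refine isFirstMax_drift_iff.2 ⟨fun i hi => ?_, fun i hi => ?_⟩
  · exact (hL.isum_nonpos hi).trans_lt (mul_pos (by positivity) (sub_pos.2 ht.2))
  · exact (hR.isum_nonpos hi).trans (mul_nonneg (by positivity) (sub_nonneg.2 ht.1))

lemma IsFirstMax.slope_mem_Ico (h : IsFirstMax (drift x t) (a + b + 2) (a + 1)) :
    t ∈ Set.Ico (psum x (a + 2)) (psum x (a + 1)) := by
  obtain ⟨hL, hR⟩ := isFirstMax_drift_iff.1 h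
  exact ⟨by simpa using hR 0 b.zero_le, by simpa using hL 0 a.zero_le⟩

lemma IsFirstMax.belowUpTo (h : IsFirstMax (drift x t) (a + b + 2) (a + 1)) (hB : -B ≤ x (a + 1)) :
    BelowUpTo B a (revSeq a x) ∧ BelowUpTo B b (shiftSeq (a + 2) x) := by
  obtain ⟨hL, hR⟩ := isFirstMax_drift_iff.1 h
  have ht := h.slope_mem_Ico
  have hjump : psum x (a + 1) - psum x (a + 2) ≤ B := by linarith [psum_succ x (a + 1)]
  constructor <;> intro i hi <;> rw [mul_comm]
  · exact (hL i hi).le.trans (by gcongr; linarith [ht.1])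
  · exact (hR i hi).trans (by gcongr; linarith [ht.2])

lemma IsFirstMax.abs_slope_mul_le {N k m : ℕ} (h : IsFirstMax (drift x t) N k) (hmk : m ≤ k)
    (hmN : k + m ≤ N) : |t| * m ≤ ∑ j ∈ Finset.range (N + 1), |psum x j| := by
  have hmk' : (m : ℝ) ≤ k := by exact_mod_cast hmk
  have hmN' : (m : ℝ) ≤ N - k := by
    rw [le_sub_iff_add_le, add_comm]
    exact_mod_cast hmN
  have hstart := h.le_of_le 0 N.zero_le
  have hend := h.le_of_le N le_rfl
  have hup := (abs_le.1 (abs_isum_sub_le x k.zero_le h.le)).2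
  have hdown := (abs_le.1 (abs_isum_sub_le x h.le le_rfl)).1
  simp only [drift, isum_zero, Nat.cast_zero, mul_zero] at hstart hend hup
  rcases le_total 0 t with ht | ht
  · rw [abs_of_nonneg ht]
    linarith [mul_le_mul_of_nonneg_left hmk' ht]
  · rw [abs_of_nonpos ht]
    linarith [mul_le_mul_of_nonneg_left hmN' (neg_nonneg.2 ht)]

/-- The slopes `t` in `[psum x (a + 2), psum x (a + 1))`, provided that the event `Q` holds both for
the part of `x` before the index `a + 1`, read backwards, and for the part after it. -/
def peakSlopes (Q : ℕ → (ℕ → ℝ) → Prop) (a b : ℕ) (x : ℕ → ℝ) : Set ℝ :=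
  {t ∈ Set.Ico (psum x (a + 2)) (psum x (a + 1)) | Q a (revSeq a x) ∧ Q b (shiftSeq (a + 2) x)}

/-- The length of `peakSlopes Q a b x`, see `volume_real_peakSlopes`. -/
noncomputable def peakWeight (Q : ℕ → (ℕ → ℝ) → Prop) (a b : ℕ) : (ℕ → ℝ) → ℝ :=
  {x | Q a (revSeq a x) ∧ Q b (shiftSeq (a + 2) x)}.indicator fun x => (x (a + 1))⁻

lemma peakSlopes_subset_Ico (Q : ℕ → (ℕ → ℝ) → Prop) (a b : ℕ) (x : ℕ → ℝ) :
    peakSlopes Q a b x ⊆ Set.Ico (psum x (a + 2)) (psum x (a + 1)) := Set.sep_subset _ _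

lemma measurableSet_peakSlopes (Q : ℕ → (ℕ → ℝ) → Prop) (a b : ℕ) (x : ℕ → ℝ) :
    MeasurableSet (peakSlopes Q a b x) :=
  measurableSet_Ico.inter (MeasurableSet.const _)

lemma volume_peakSlopes_lt_top (Q : ℕ → (ℕ → ℝ) → Prop) (a b : ℕ) (x : ℕ → ℝ) :
    volume (peakSlopes Q a b x) < ⊤ :=
  (measure_mono (peakSlopes_subset_Ico Q a b x)).trans_lt measure_Ico_lt_top

lemma volume_real_peakSlopes (Q : ℕ → (ℕ → ℝ) → Prop) (a b : ℕ) (x : ℕ → ℝ) :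
    volume.real (peakSlopes Q a b x) = peakWeight Q a b x := by
  by_cases hQ : x ∈ {x | Q a (revSeq a x) ∧ Q b (shiftSeq (a + 2) x)}
  · have hIco : peakSlopes Q a b x = Set.Ico (psum x (a + 2)) (psum x (a + 1)) :=
      Set.sep_eq_self_iff_mem_true.2 fun _ _ => hQ
    rw [hIco, Real.volume_real_Ico, peakWeight, Set.indicator_of_mem hQ, negPart_def,
      psum_succ x (a + 1), sub_add_cancel_left]
  · have hempty : peakSlopes Q a b x = ∅ := Set.sep_eq_empty_iff_mem_false.2 fun _ _ => hQ
    rw [hempty, measureReal_empty, peakWeight, Set.indicator_of_notMem hQ]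

lemma sum_peakWeight_negUpTo_le (x : ℕ → ℝ) (m : ℕ) :
    ∑ a ∈ Finset.Icc m (2 * m), peakWeight NegUpTo a (3 * m - a) x ≤
      2 / (m + 1) * ∑ j ∈ Finset.range (3 * m + 3), |psum x j| := by
  set T := ∑ j ∈ Finset.range (3 * m + 3), |psum x j|
  have hT : 0 ≤ T := Finset.sum_nonneg fun _ _ => abs_nonneg _
  let s : ℕ → Set ℝ := fun a => peakSlopes NegUpTo a (3 * m - a) x
  have hpeak {a : ℕ} (ha : a ∈ Finset.Icc m (2 * m)) {t : ℝ} (ht : t ∈ s a) :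
      IsFirstMax (drift x t) (3 * m + 2) (a + 1) := by
    have hN : 3 * m + 2 = a + (3 * m - a) + 2 := by have := Finset.mem_Icc.1 ha; omega
    exact hN ▸ isFirstMax_drift_of_negUpTo ht.2.1 ht.2.2 ht.1
  have hdisj : (Finset.Icc m (2 * m) : Set ℕ).PairwiseDisjoint s := fun a ha a' ha' hne =>
    Set.disjoint_left.2 fun t ht ht' =>
      hne (Nat.succ_injective ((hpeak ha ht).unique (hpeak ha' ht')))
  have hsub : (⋃ a ∈ Finset.Icc m (2 * m), s a) ⊆ Set.Icc (-(T / (m + 1))) (T / (m + 1)) := by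
    refine Set.iUnion₂_subset fun a ha t ht => abs_le.1 ?_
    have ham := Finset.mem_Icc.1 ha
    rw [le_div_iff₀ (by positivity)]
    exact_mod_cast (hpeak ha ht).abs_slope_mul_le (m := m + 1) (by omega) (by omega)
  calc ∑ a ∈ Finset.Icc m (2 * m), peakWeight NegUpTo a (3 * m - a) x
      = ∑ a ∈ Finset.Icc m (2 * m), volume.real (s a) :=
        Finset.sum_congr rfl fun _ _ => (volume_real_peakSlopes _ _ _ x).symm
    _ = volume.real (⋃ a ∈ Finset.Icc m (2 * m), s a) :=
        (measureReal_biUnion_finset hdisj (fun _ _ => measurableSet_peakSlopes _ _ _ x)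
          fun _ _ => (volume_peakSlopes_lt_top _ _ _ x).ne).symm
    _ ≤ volume.real (Set.Icc (-(T / (m + 1))) (T / (m + 1))) :=
        measureReal_mono hsub measure_Icc_lt_top.ne
    _ = 2 / (m + 1) * T := by
      rw [Real.volume_real_Icc_of_le (neg_le_self (div_nonneg hT (by positivity)))]
      ring

lemma exists_mem_peakSlopes_belowUpTo (hB : ∀ i, -B ≤ x i) {n : ℕ}
    (ht : t ∈ Set.Ico (psum x (n + 2)) (psum x 1)) :
    ∃ a ∈ Finset.range (n + 1), t ∈ peakSlopes (BelowUpTo B) a (n - a) x := by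
  obtain ⟨k, hk⟩ := exists_isFirstMax (drift x t) (n + 2)
  have hne_zero : k ≠ 0 := by
    rintro rfl
    have := hk.le_of_le 1 (by omega)
    linarith [drift_succ x t 0, ht.2]
  have hne_top : k ≠ n + 2 := by
    rintro rfl
    have := hk.lt_of_lt (n + 1) (by omega)
    linarith [drift_succ x t (n + 1), ht.1]
  obtain ⟨a, rfl⟩ := Nat.exists_eq_succ_of_ne_zero hne_zero
  obtain ⟨b, rfl⟩ : ∃ b, n = a + b := Nat.exists_eq_add_of_le (by have := hk.le; omega)
  refine ⟨a, Finset.mem_range.2 (by omega), ?_⟩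
  rw [Nat.add_sub_cancel_left]
  exact ⟨hk.slope_mem_Ico, hk.belowUpTo (hB _)⟩

lemma negPart_psum_le_sum_peakWeight (hB : ∀ i, -B ≤ x i) (n : ℕ) :
    (psum (shiftSeq 1 x) (n + 1))⁻ ≤
      ∑ a ∈ Finset.range (n + 1), peakWeight (BelowUpTo B) a (n - a) x := by
  let s : ℕ → Set ℝ := fun a => peakSlopes (BelowUpTo B) a (n - a) x
  have hsub : Set.Ico (psum x (n + 2)) (psum x 1) ⊆ ⋃ a ∈ Finset.range (n + 1), s a :=
    fun _ ht =>
      let ⟨_, ha, hmem⟩ := exists_mem_peakSlopes_belowUpTo hB ht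
      Set.mem_biUnion ha hmem
  have hsum : psum x (n + 2) = psum x 1 + psum (shiftSeq 1 x) (n + 1) := by
    rw [← psum_add, add_comm 1 (n + 1)]
  calc (psum (shiftSeq 1 x) (n + 1))⁻ = volume.real (Set.Ico (psum x (n + 2)) (psum x 1)) := by
        rw [Real.volume_real_Ico, hsum, negPart_def, sub_add_cancel_left]
    _ ≤ volume.real (⋃ a ∈ Finset.range (n + 1), s a) :=
        measureReal_mono hsub (measure_biUnion_lt_top (Finset.finite_toSet _) fun _ _ =>
          volume_peakSlopes_lt_top _ _ _ x).ne
    _ ≤ ∑ a ∈ Finset.range (n + 1), volume.real (s a) := measureReal_biUnion_finset_le _ _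
    _ = ∑ a ∈ Finset.range (n + 1), peakWeight (BelowUpTo B) a (n - a) x :=
        Finset.sum_congr rfl fun _ _ => volume_real_peakSlopes _ _ _ x

end Peaks

section PrefixEvents

variable {m : ℕ}

@[fun_prop]
lemma measurable_psum (n : ℕ) : Measurable fun x : ℕ → ℝ => psum x n := by
  unfold psum; fun_prop

@[fun_prop]
lemma measurable_isum (n : ℕ) : Measurable fun x : ℕ → ℝ => isum x n := by
  unfold isum; fun_prop

@[fun_prop]
lemma measurable_revSeq (a : ℕ) : Measurable (revSeq a) := by
  unfold revSeq; fun_prop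

@[fun_prop]
lemma measurable_shiftSeq (a : ℕ) : Measurable (shiftSeq a) := by
  unfold shiftSeq; fun_prop

/-- A family of events `Q m` about real sequences, each of which is measurable and concerns the
first `m` terms only. -/
structure IsPrefixEvent (Q : ℕ → (ℕ → ℝ) → Prop) : Prop where
  measurableSet : ∀ m, MeasurableSet {x | Q m x}
  dependsOn : ∀ m, DependsOn (Q m) (Set.Iio m)

lemma isPrefixEvent_negUpTo : IsPrefixEvent NegUpTo where
  measurableSet m := by
    simp only [NegUpTo, Set.ofPred_forall]
    exact Finset.measurableSet_biInter _ fun j _ =>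
      measurableSet_lt (measurable_isum j) measurable_const
  dependsOn m x y h := by
    refine propext (forall₂_congr fun j hj => ?_)
    rw [isum_congr fun i hi => h i (hi.trans_le (Finset.mem_Icc.1 hj).2)]

lemma isPrefixEvent_belowUpTo (B : ℝ) : IsPrefixEvent (BelowUpTo B) where
  measurableSet m := by
    simp only [BelowUpTo, Set.ofPred_forall]
    exact .iInter fun j => .iInter fun _ => measurableSet_le (measurable_isum j) measurable_const
  dependsOn m x y h := by
    refine propext (forall₂_congr fun j hj => ?_)
    rw [isum_congr fun i hi => h i (hi.trans_le hj)]

lemma isPrefixEvent_forall_lt_mem {A : Set ℝ} (hA : MeasurableSet A) :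
    IsPrefixEvent fun m x => ∀ i < m, x i ∈ A where
  measurableSet m := by
    simp only [Set.ofPred_forall]
    exact .iInter fun i => .iInter fun _ => measurable_pi_apply i hA
  dependsOn m x y h := propext (forall₂_congr fun i hi => by rw [h i hi])

lemma IsPrefixEvent.dependsOn_revSeq {Q : ℕ → (ℕ → ℝ) → Prop} (hQ : IsPrefixEvent Q) (a : ℕ) :
    DependsOn (fun x => Q a (revSeq a x)) (Finset.range (a + 1)) := fun x y h =>
  hQ.dependsOn a fun i hi => h _ <| by
    rw [revIdx_of_le (Set.mem_Iio.1 hi).le]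
    simp only [Finset.coe_range, Set.mem_Iio]
    omega

lemma IsPrefixEvent.dependsOn_shiftSeq {Q : ℕ → (ℕ → ℝ) → Prop} (hQ : IsPrefixEvent Q)
    (a b : ℕ) : DependsOn (fun x => Q b (shiftSeq a x)) (Finset.Ico a (a + b)) := fun x y h =>
  hQ.dependsOn b fun i hi => h _ <| by
    simp only [Finset.coe_Ico, Set.mem_Ico, Set.mem_Iio] at hi ⊢
    omega

end PrefixEvents

section Independence

variable {Ω ι β γ : Type*} {𝓧 : ι → Type*}

lemma eq_updateFinset_restrict_of_dependsOn [DecidableEq ι] {S : Finset ι} {F : (∀ i, 𝓧 i) → β}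
    (hF : DependsOn F S) (z x : ∀ i, 𝓧 i) : F x = F (Function.updateFinset z S (S.restrict x)) :=
  hF fun i hi => by simp [Function.updateFinset, Finset.mem_coe.1 hi]

lemma dependsOn_indicator {M : Type*} [Zero M] {p : (∀ i, 𝓧 i) → Prop} {F : (∀ i, 𝓧 i) → M}
    {s t : Set ι} (hp : DependsOn p s) (hF : DependsOn F t) :
    DependsOn ({x | p x}.indicator F) (s ∪ t) := by
  intro x y h
  have hiff : x ∈ {x | p x} ↔ y ∈ {x | p x} := iff_of_eq (hp fun i hi => h i (.inl hi))
  have hFxy : F x = F y := hF fun i hi => h i (.inr hi)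
  by_cases hx : x ∈ {x | p x}
  · rw [Set.indicator_of_mem hx, Set.indicator_of_mem (hiff.1 hx), hFxy]
  · rw [Set.indicator_of_notMem hx, Set.indicator_of_notMem (mt hiff.2 hx)]

variable [MeasurableSpace Ω] [∀ i, MeasurableSpace (𝓧 i)]
  [∀ i, Nonempty (𝓧 i)] [MeasurableSpace β] [MeasurableSpace γ] {P : Measure Ω}
  {X : ∀ i, Ω → 𝓧 i} {S T : Finset ι}

lemma indepFun_of_dependsOn (hX : iIndepFun X P) (hXm : ∀ i, Measurable (X i))
    (hST : Disjoint S T) {F : (∀ i, 𝓧 i) → β} {G : (∀ i, 𝓧 i) → γ} (hF : Measurable F)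
    (hG : Measurable G) (hFS : DependsOn F S) (hGT : DependsOn G T) :
    IndepFun (fun ω => F (X · ω)) (fun ω => G (X · ω)) P := by
  classical
  let z : ∀ i, 𝓧 i := fun _ => Classical.arbitrary _
  rw [funext fun ω => eq_updateFinset_restrict_of_dependsOn hFS z (X · ω),
    funext fun ω => eq_updateFinset_restrict_of_dependsOn hGT z (X · ω)]
  exact (hX.indepFun_finset S T hST hXm).comp (hF.comp measurable_updateFinset)
    (hG.comp measurable_updateFinset)

lemma integral_indicator_of_dependsOn (hX : iIndepFun X P) (hXm : ∀ i, Measurable (X i))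
    (hST : Disjoint S T) {p : (∀ i, 𝓧 i) → Prop} {F : (∀ i, 𝓧 i) → ℝ}
    (hp : MeasurableSet {x | p x}) (hF : Measurable F) (hpS : DependsOn p S)
    (hFT : DependsOn F T) :
    ∫ ω, {x | p x}.indicator F (X · ω) ∂P = P.real {ω | p (X · ω)} * ∫ ω, F (X · ω) ∂P := by
  have hXseq : Measurable fun ω i => X i ω := measurable_pi_iff.2 hXm
  have hpS' : DependsOn ({x | p x}.indicator (1 : (∀ i, 𝓧 i) → ℝ)) S :=
    Set.union_empty (S : Set ι) ▸ dependsOn_indicator hpS (dependsOn_const (1 : ℝ))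
  have hind := indepFun_of_dependsOn hX hXm hST (measurable_one.indicator hp) hF hpS' hFT
  have hprob : ∫ ω, {x | p x}.indicator 1 (X · ω) ∂P = P.real {ω | p (X · ω)} :=
    integral_indicator_one (hXseq hp)
  rw [← hprob, ← hind.integral_fun_mul_eq_mul_integral
    ((measurable_one.indicator hp).comp hXseq).aestronglyMeasurable
    (hF.comp hXseq).aestronglyMeasurable]
  refine integral_congr_ae (ae_of_all _ fun ω => ?_)
  by_cases hω : (X · ω) ∈ {x | p x} <;> simp [hω]

lemma measureReal_and_of_dependsOn (hX : iIndepFun X P) (hXm : ∀ i, Measurable (X i))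
    (hST : Disjoint S T) {p q : (∀ i, 𝓧 i) → Prop} (hp : MeasurableSet {x | p x})
    (hq : MeasurableSet {x | q x}) (hpS : DependsOn p S) (hqT : DependsOn q T) :
    P.real {ω | p (X · ω) ∧ q (X · ω)} = P.real {ω | p (X · ω)} * P.real {ω | q (X · ω)} := by
  have hind := indepFun_of_dependsOn hX hXm hST (measurableSet_setOfPred.1 hp)
    (measurableSet_setOfPred.1 hq) hpS hqT
  have hmul := hind.measure_inter_preimage_eq_mul {True} {True} (.singleton _) (.singleton _)
  simp only [Set.preimage, Set.mem_singleton_iff, eq_iff_iff, iff_true] at hmul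
  rw [measureReal_def, measureReal_def, measureReal_def, ← ENNReal.toReal_mul, ← hmul]
  rfl

end Independence

section IID

variable {Ω : Type*} [MeasurableSpace Ω] {P : Measure Ω} {X : ℕ → Ω → ℝ}

namespace IsIIDSeq

lemma measurable_seq (h : IsIIDSeq P X) : Measurable fun ω i => X i ω :=
  measurable_pi_iff.2 h.measurable

lemma integrable (h : IsIIDSeq P X) (hi : Integrable (X 0) P) (i : ℕ) : Integrable (X i) P :=
  (h.identDistrib i).integrable_iff.2 hi

lemma ae_all_mem (h : IsIIDSeq P X) {A : Set ℝ} (hA : MeasurableSet A)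
    (h0 : ∀ᵐ ω ∂P, X 0 ω ∈ A) : ∀ᵐ ω ∂P, ∀ i, X i ω ∈ A :=
  ae_all_iff.2 fun i => (h.identDistrib i).symm.ae_mem_snd hA h0

lemma precomp (h : IsIIDSeq P X) {σ : ℕ → ℕ} (hσ : Function.Injective σ) :
    IsIIDSeq P fun i => X (σ i) where
  measurable _ := h.measurable _
  indep := h.indep.precomp hσ
  identDistrib _ := (h.identDistrib _).trans (h.identDistrib _).symm

lemma identDistrib_precomp (h : IsIIDSeq P X) {σ : ℕ → ℕ} (hσ : Function.Injective σ) :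
    IdentDistrib (fun ω i => X (σ i) ω) (fun ω i => X i ω) P P where
  aemeasurable_fst := (h.precomp hσ).measurable_seq.aemeasurable
  aemeasurable_snd := h.measurable_seq.aemeasurable
  map_eq := by
    rw [(h.precomp hσ).indep.map_fun_eq_infinitePi_map fun i => h.measurable _,
      h.indep.map_fun_eq_infinitePi_map h.measurable]
    congr 1 with i : 1
    exact ((h.identDistrib _).trans (h.identDistrib _).symm).map_eq

lemma measureReal_precomp (h : IsIIDSeq P X) {σ : ℕ → ℕ} (hσ : Function.Injective σ)
    {p : (ℕ → ℝ) → Prop} (hp : MeasurableSet {x | p x}) :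
    P.real {ω | p fun i => X (σ i) ω} = P.real {ω | p (X · ω)} :=
  congrArg ENNReal.toReal ((h.identDistrib_precomp hσ).measure_mem_eq hp)

lemma measureReal_forall_lt_mem (h : IsIIDSeq P X) (r : ℕ) {A : Set ℝ} (hA : MeasurableSet A) :
    P.real {ω | ∀ i < r, X i ω ∈ A} = P.real {ω | X 0 ω ∈ A} ^ r := by
  have hprod := h.indep.measure_inter_preimage_eq_mul (Finset.range r) (sets := fun _ => A)
    fun _ _ => hA
  have hident (i : ℕ) : P (X i ⁻¹' A) = P {ω | X 0 ω ∈ A} := (h.identDistrib i).measure_mem_eq hA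
  have hset : {ω | ∀ i < r, X i ω ∈ A} = ⋂ i ∈ Finset.range r, X i ⁻¹' A := by ext; simp
  rw [hset, measureReal_def, hprod]
  simp only [hident, Finset.prod_const, Finset.card_range, ENNReal.toReal_pow, measureReal_def]

lemma integral_peakWeight (h : IsIIDSeq P X) {Q : ℕ → (ℕ → ℝ) → Prop} (hQ : IsPrefixEvent Q)
    (a b : ℕ) : ∫ ω, peakWeight Q a b (X · ω) ∂P =
      P.real {ω | Q a (X · ω)} * P.real {ω | Q b (X · ω)} * ∫ ω, (X 0 ω)⁻ ∂P := by
  let u : (ℕ → ℝ) → ℝ := fun x => (x (a + 1))⁻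
  let v : (ℕ → ℝ) → ℝ := {x | Q b (shiftSeq (a + 2) x)}.indicator u
  have hmL : MeasurableSet {x | Q a (revSeq a x)} := measurable_revSeq a (hQ.measurableSet a)
  have hmR : MeasurableSet {x | Q b (shiftSeq (a + 2) x)} :=
    measurable_shiftSeq (a + 2) (hQ.measurableSet b)
  have hu : Measurable u := by fun_prop
  have hdu : DependsOn u ({a + 1} : Finset ℕ) := fun x y hxy => by
    simp only [u, hxy (a + 1) (by simp)]
  have hdv : DependsOn v (Finset.Ico (a + 2) (a + 2 + b) ∪ {a + 1} : Finset ℕ) := by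
    rw [Finset.coe_union]
    exact dependsOn_indicator (hQ.dependsOn_shiftSeq (a + 2) b) hdu
  have hsplit : peakWeight Q a b = {x | Q a (revSeq a x)}.indicator v :=
    (Set.indicator_indicator _ _ u).symm
  have hident : ∫ ω, u (X · ω) ∂P = ∫ ω, (X 0 ω)⁻ ∂P :=
    ((h.identDistrib (a + 1)).comp measurable_id.negPart).integral_eq
  rw [hsplit, integral_indicator_of_dependsOn h.indep h.measurable ?_ hmL (hu.indicator hmR)
      (hQ.dependsOn_revSeq a) hdv,
    integral_indicator_of_dependsOn h.indep h.measurable ?_ hmR hu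
      (hQ.dependsOn_shiftSeq (a + 2) b) hdu, hident, mul_assoc]
  · congr 1
    · exact h.measureReal_precomp (revIdx_injective a) (hQ.measurableSet a)
    · congr 1
      exact h.measureReal_precomp (add_right_injective (a + 2)) (hQ.measurableSet b)
  · simp
  · rw [Finset.disjoint_left]
    intro i hi
    simp only [Finset.mem_range, Finset.mem_union, Finset.mem_Ico, Finset.mem_singleton] at hi ⊢
    omega

lemma integrable_peakWeight (h : IsIIDSeq P X) (hi : Integrable (X 0) P)
    {Q : ℕ → (ℕ → ℝ) → Prop} (hQ : IsPrefixEvent Q) (a b : ℕ) :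
    Integrable (fun ω => peakWeight Q a b (X · ω)) P := by
  have hmeas : MeasurableSet {x | Q a (revSeq a x) ∧ Q b (shiftSeq (a + 2) x)} :=
    (measurable_revSeq a (hQ.measurableSet a)).inter
      (measurable_shiftSeq (a + 2) (hQ.measurableSet b))
  exact (h.integrable hi (a + 1)).neg_part.indicator (h.measurable_seq hmeas)

lemma integrable_partialSum (h : IsIIDSeq P X) (hi : Integrable (X 0) P) (n : ℕ) :
    Integrable (partialSum X n) P :=
  integrable_finsetSum _ fun i _ => h.integrable hi i

lemma integral_partialSum (h : IsIIDSeq P X) (hi : Integrable (X 0) P) (n : ℕ) :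
    ∫ ω, partialSum X n ω ∂P = n * ∫ ω, X 0 ω ∂P := by
  simp only [partialSum]
  rw [integral_finsetSum _ fun i _ => h.integrable hi i]
  simp [fun i => (h.identDistrib i).integral_eq]

lemma integral_abs_partialSum_le (h : IsIIDSeq P X) (hi : Integrable (X 0) P) (n : ℕ) :
    ∫ ω, |partialSum X n ω| ∂P ≤ n * ∫ ω, |X 0 ω| ∂P := by
  have hident (i : ℕ) : ∫ ω, |X i ω| ∂P = ∫ ω, |X 0 ω| ∂P :=
    ((h.identDistrib i).comp measurable_id.abs).integral_eq
  calc ∫ ω, |partialSum X n ω| ∂P ≤ ∫ ω, ∑ i ∈ Finset.range n, |X i ω| ∂P :=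
        integral_mono (h.integrable_partialSum hi n).abs
          (integrable_finsetSum _ fun i _ => (h.integrable hi i).abs)
          fun ω => Finset.abs_sum_le_sum_abs _ _
    _ = n * ∫ ω, |X 0 ω| ∂P := by
      rw [integral_finsetSum _ fun i _ => (h.integrable hi i).abs]
      simp [hident]

end IsIIDSeq

lemma integral_abs_eq_two_mul_integral_negPart {f : Ω → ℝ} (hf : Integrable f P)
    (h0 : ∫ ω, f ω ∂P = 0) : ∫ ω, |f ω| ∂P = 2 * ∫ ω, (f ω)⁻ ∂P := by
  rw [integral_abs_eq_two_mul_integral_negPart_add_integral hf, h0, add_zero]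

lemma measure_neg_ne_zero_of_integral_negPart_pos {f : Ω → ℝ} (h : 0 < ∫ ω, (f ω)⁻ ∂P) :
    P {ω | f ω < 0} ≠ 0 := by
  intro hzero
  have hae : ∀ᵐ ω ∂P, 0 ≤ f ω := by
    simpa only [ae_iff, not_le] using hzero
  refine h.ne' (integral_eq_zero_of_ae ?_)
  filter_upwards [hae] with ω hω using negPart_eq_zero.2 hω

lemma persistenceProb_antitone [IsFiniteMeasure P] : Antitone (persistenceProb P X) :=
  fun _ _ hmn => measureReal_mono fun _ h => NegUpTo.mono hmn h

namespace IsIIDSeq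

lemma sum_persistenceProb_mul_le (h : IsIIDSeq P X) (hi : Integrable (X 0) P) (m : ℕ) :
    ∑ a ∈ Finset.Icc m (2 * m), persistenceProb P X a * persistenceProb P X (3 * m - a) *
        ∫ ω, (X 0 ω)⁻ ∂P ≤
      2 / (m + 1) * ∑ j ∈ Finset.range (3 * m + 3), ∫ ω, |partialSum X j ω| ∂P := by
  have hw (a : ℕ) := h.integrable_peakWeight hi isPrefixEvent_negUpTo a (3 * m - a)
  have hS (j : ℕ) := (h.integrable_partialSum hi j).abs
  calc ∑ a ∈ Finset.Icc m (2 * m), persistenceProb P X a * persistenceProb P X (3 * m - a) *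
        ∫ ω, (X 0 ω)⁻ ∂P
      = ∫ ω, ∑ a ∈ Finset.Icc m (2 * m), peakWeight NegUpTo a (3 * m - a) (X · ω) ∂P := by
        rw [integral_finsetSum _ fun a _ => hw a]
        exact Finset.sum_congr rfl fun a _ => (h.integral_peakWeight isPrefixEvent_negUpTo _ _).symm
    _ ≤ ∫ ω, 2 / (m + 1) * ∑ j ∈ Finset.range (3 * m + 3), |partialSum X j ω| ∂P :=
        integral_mono (integrable_finsetSum _ fun a _ => hw a)
          ((integrable_finsetSum _ fun j _ => hS j).const_mul _)
          fun ω => sum_peakWeight_negUpTo_le (X · ω) m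
    _ = 2 / (m + 1) * ∑ j ∈ Finset.range (3 * m + 3), ∫ ω, |partialSum X j ω| ∂P := by
        rw [integral_const_mul, integral_finsetSum _ fun j _ => hS j]

lemma integral_abs_partialSum_le_sum_belowUpTo (h : IsIIDSeq P X) (hi : Integrable (X 0) P)
    (h0 : ∫ ω, X 0 ω ∂P = 0) {B : ℝ} (hB : ∀ᵐ ω ∂P, -B ≤ X 0 ω) (n : ℕ) :
    ∫ ω, |partialSum X (n + 1) ω| ∂P ≤
      2 * (∑ a ∈ Finset.range (n + 1), P.real {ω | BelowUpTo B a (X · ω)} *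
        P.real {ω | BelowUpTo B (n - a) (X · ω)} * ∫ ω, (X 0 ω)⁻ ∂P) := by
  have hw (a : ℕ) := h.integrable_peakWeight hi (isPrefixEvent_belowUpTo B) a (n - a)
  have hident : IdentDistrib (fun ω => psum (shiftSeq 1 (X · ω)) (n + 1)) (partialSum X (n + 1))
      P P := (h.identDistrib_precomp (add_right_injective 1)).comp (measurable_psum (n + 1))
  have hshift : Integrable (fun ω => (psum (shiftSeq 1 (X · ω)) (n + 1))⁻) P :=
    (hident.integrable_iff.2 (h.integrable_partialSum hi (n + 1))).neg_part
  calc ∫ ω, |partialSum X (n + 1) ω| ∂P = 2 * ∫ ω, (partialSum X (n + 1) ω)⁻ ∂P :=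
        integral_abs_eq_two_mul_integral_negPart (h.integrable_partialSum hi _)
          (by rw [h.integral_partialSum hi, h0, mul_zero])
    _ = 2 * ∫ ω, (psum (shiftSeq 1 (X · ω)) (n + 1))⁻ ∂P :=
        congrArg (2 * ·) (hident.comp measurable_id.negPart).integral_eq.symm
    _ ≤ 2 * ∫ ω, ∑ a ∈ Finset.range (n + 1), peakWeight (BelowUpTo B) a (n - a) (X · ω) ∂P := by
        refine mul_le_mul_of_nonneg_left
          (integral_mono_ae hshift (integrable_finsetSum _ fun a _ => hw a) ?_) zero_le_two
        filter_upwards [h.ae_all_mem measurableSet_Ici hB] with ω hω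
        exact negPart_psum_le_sum_peakWeight hω n
    _ = _ := by
        rw [integral_finsetSum _ fun a _ => hw a]
        simp only [h.integral_peakWeight (isPrefixEvent_belowUpTo B)]

/-- A few very negative initial terms absorb the line in `BelowUpTo`. -/
lemma pow_mul_measureReal_belowUpTo_le [IsFiniteMeasure P] (h : IsIIDSeq P X) {B δ : ℝ} {r : ℕ}
    (hB : B < r * δ) (m : ℕ) :
    P.real {ω | X 0 ω ≤ -δ} ^ r * P.real {ω | BelowUpTo B m (X · ω)} ≤ persistenceProb P X m := by
  have hA : IsPrefixEvent fun m x => ∀ i < m, x i ∈ Set.Iic (-δ) :=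
    isPrefixEvent_forall_lt_mem measurableSet_Iic
  have hQ := isPrefixEvent_belowUpTo B
  have hdisj : Disjoint (Finset.range r) (Finset.Ico r (r + m)) := by
    rw [Finset.disjoint_left]
    intro i hi
    simp only [Finset.mem_range, Finset.mem_Ico] at hi ⊢
    omega
  have hind : P.real {ω | (∀ i < r, X i ω ∈ Set.Iic (-δ)) ∧ BelowUpTo B m (shiftSeq r (X · ω))} =
      P.real {ω | ∀ i < r, X i ω ∈ Set.Iic (-δ)} *
        P.real {ω | BelowUpTo B m (shiftSeq r (X · ω))} :=
    measureReal_and_of_dependsOn h.indep h.measurable hdisj (hA.measurableSet r)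
      (measurable_shiftSeq r (hQ.measurableSet m)) (Finset.coe_range r ▸ hA.dependsOn r)
      (hQ.dependsOn_shiftSeq r m)
  have hshift : P.real {ω | BelowUpTo B m (shiftSeq r (X · ω))} =
      P.real {ω | BelowUpTo B m (X · ω)} :=
    h.measureReal_precomp (add_right_injective r) (hQ.measurableSet m)
  calc P.real {ω | X 0 ω ≤ -δ} ^ r * P.real {ω | BelowUpTo B m (X · ω)}
      = P.real {ω | (∀ i < r, X i ω ∈ Set.Iic (-δ)) ∧ BelowUpTo B m (shiftSeq r (X · ω))} := by
        rw [hind, h.measureReal_forall_lt_mem r measurableSet_Iic, hshift]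
        rfl
    _ ≤ persistenceProb P X m :=
        measureReal_mono fun ω hω => negUpTo_of_belowUpTo hB hω.1 hω.2

lemma exists_measureReal_belowUpTo_le [IsFiniteMeasure P] (h : IsIIDSeq P X)
    (hneg : P {ω | X 0 ω < 0} ≠ 0) (B : ℝ) :
    ∃ K > 0, ∀ m, P.real {ω | BelowUpTo B m (X · ω)} ≤ K * persistenceProb P X m := by
  obtain ⟨δ, hδ, hq⟩ : ∃ δ > 0, 0 < P.real {ω | X 0 ω ≤ -δ} := by
    have hUnion : {ω | X 0 ω < 0} ⊆ ⋃ n : ℕ, {ω | X 0 ω ≤ -(1 / ((n : ℝ) + 1))} := fun ω hω => by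
      have hpos : 0 < -X 0 ω := neg_pos.2 hω
      obtain ⟨n, hn⟩ := exists_nat_one_div_lt hpos
      exact Set.mem_iUnion.2 ⟨n, le_neg.2 hn.le⟩
    obtain ⟨n, hn⟩ := exists_measure_pos_of_not_measure_iUnion_null
      fun h0 => hneg (measure_mono_null hUnion h0)
    exact ⟨_, Nat.one_div_pos_of_nat, ENNReal.toReal_pos hn.ne' (measure_ne_top P _)⟩
  obtain ⟨r, hr⟩ := exists_nat_gt (B / δ)
  refine ⟨(P.real {ω | X 0 ω ≤ -δ} ^ r)⁻¹, by positivity, fun m => ?_⟩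
  rw [← div_eq_inv_mul, le_div_iff₀' (by positivity)]
  exact h.pow_mul_measureReal_belowUpTo_le ((div_lt_iff₀ hδ).1 hr) m

end IsIIDSeq

end IID

/-! ### From convolutions to persistence exponents -/

section RegularVariation

variable {p : ℕ → ℝ}

lemma one_sub_mul_rpow_neg_le_sub {γ : ℝ} (h0 : 0 ≤ γ) (h1 : γ ≤ 1) {x : ℝ} (hx : 0 ≤ x) :
    (1 - γ) * (x + 1) ^ (-γ) ≤ (x + 1) ^ (1 - γ) - x ^ (1 - γ) := by
  have hx1 : 0 < x + 1 := by positivity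
  have hfactor : (x + 1) ^ (1 - γ) = (x + 1) ^ (-γ) * (x + 1) := by
    rw [← Real.rpow_add_one hx1.ne', neg_add_eq_sub]
  have hbernoulli : (x / (x + 1)) ^ (1 - γ) ≤ 1 + (1 - γ) * (-1 / (x + 1)) := by
    have hs : -1 ≤ -1 / (x + 1) := by rw [le_div_iff₀ hx1]; linarith
    convert rpow_one_add_le_one_add_mul_self hs (sub_nonneg.2 h1) (by linarith) using 2
    field_simp
    ring
  rw [Real.div_rpow hx hx1.le, div_le_iff₀ (by positivity)] at hbernoulli
  calc (1 - γ) * (x + 1) ^ (-γ)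
      = (x + 1) ^ (1 - γ) - (1 + (1 - γ) * (-1 / (x + 1))) * (x + 1) ^ (1 - γ) := by
        rw [hfactor]; field_simp; ring
    _ ≤ (x + 1) ^ (1 - γ) - x ^ (1 - γ) := by gcongr

lemma sum_range_rpow_neg_le {γ : ℝ} (h0 : 0 ≤ γ) (h1 : γ < 1) (n : ℕ) :
    ∑ k ∈ Finset.range n, ((k : ℝ) + 1) ^ (-γ) ≤ (n : ℝ) ^ (1 - γ) / (1 - γ) := by
  have hγ : 0 < 1 - γ := sub_pos.2 h1
  rw [le_div_iff₀' hγ, Finset.mul_sum]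
  calc ∑ k ∈ Finset.range n, (1 - γ) * ((k : ℝ) + 1) ^ (-γ)
      ≤ ∑ k ∈ Finset.range n, (((k + 1 : ℕ) : ℝ) ^ (1 - γ) - (k : ℝ) ^ (1 - γ)) := by
        refine Finset.sum_le_sum fun k _ => ?_
        push_cast
        exact one_sub_mul_rpow_neg_le_sub h0 h1.le k.cast_nonneg
    _ = (n : ℝ) ^ (1 - γ) := by
        rw [Finset.sum_range_sub fun k : ℕ => (k : ℝ) ^ (1 - γ)]
        simp [Real.zero_rpow hγ.ne']

lemma sum_range_succ_le_of_le_rpow_neg {γ D : ℝ} (h0 : 0 ≤ γ) (h1 : γ < 1) (hD : 0 ≤ D)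
    (hp : ∀ n : ℕ, 1 ≤ n → p n ≤ D * (n : ℝ) ^ (-γ)) (n : ℕ) :
    ∑ k ∈ Finset.range (n + 1), p k ≤ D * ((n : ℝ) ^ (1 - γ) / (1 - γ)) + p 0 := by
  rw [Finset.sum_range_succ']
  gcongr
  calc ∑ k ∈ Finset.range n, p (k + 1) ≤ ∑ k ∈ Finset.range n, D * ((k : ℝ) + 1) ^ (-γ) :=
        Finset.sum_le_sum fun k _ => by exact_mod_cast hp (k + 1) k.succ_pos
    _ ≤ D * ((n : ℝ) ^ (1 - γ) / (1 - γ)) := by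
        rw [← Finset.mul_sum]
        exact mul_le_mul_of_nonneg_left (sum_range_rpow_neg_le h0 h1 n) hD

lemma sum_range_mul_sub_le_of_antitone (hp : Antitone p) (h0 : ∀ k, 0 ≤ p k) (m : ℕ) :
    ∑ k ∈ Finset.range (2 * m + 1), p k * p (2 * m - k) ≤
      2 * p m * ∑ k ∈ Finset.range (2 * m + 1), p k := by
  have hreflect : ∑ k ∈ Finset.range (2 * m + 1), p (2 * m - k) =
      ∑ k ∈ Finset.range (2 * m + 1), p k := by
    simpa using Finset.sum_range_reflect p (2 * m + 1)
  have hterm (k : ℕ) : p k * p (2 * m - k) ≤ p m * p k + p m * p (2 * m - k) := by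
    rcases le_total k m with hk | hk
    · have := mul_le_mul_of_nonneg_left (hp (by omega : m ≤ 2 * m - k)) (h0 k)
      linarith [mul_nonneg (h0 m) (h0 (2 * m - k))]
    · have := mul_le_mul_of_nonneg_right (hp hk) (h0 (2 * m - k))
      linarith [mul_nonneg (h0 m) (h0 k)]
  calc ∑ k ∈ Finset.range (2 * m + 1), p k * p (2 * m - k)
      ≤ ∑ k ∈ Finset.range (2 * m + 1), (p m * p k + p m * p (2 * m - k)) :=
        Finset.sum_le_sum fun k _ => hterm k
    _ = 2 * p m * ∑ k ∈ Finset.range (2 * m + 1), p k := by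
        rw [Finset.sum_add_distrib, ← Finset.mul_sum, ← Finset.mul_sum, hreflect]
        ring

lemma exists_mul_rpow_neg_le_of_le_sum_mul (hp : Antitone p) (h0 : ∀ k, 0 ≤ p k) {γ c D : ℝ}
    (hγ0 : 0 ≤ γ) (hγ1 : γ < 1) (hc : 0 < c) (hD : 0 ≤ D)
    (hle : ∀ n : ℕ, 1 ≤ n → p n ≤ D * (n : ℝ) ^ (-γ))
    (hsum : ∀ m : ℕ, 1 ≤ m →
      c * (m : ℝ) ^ (1 - 2 * γ) ≤ ∑ k ∈ Finset.range (2 * m + 1), p k * p (2 * m - k)) :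
    ∃ K > 0, ∀ n : ℕ, 1 ≤ n → K * (n : ℝ) ^ (-γ) ≤ p n := by
  have hγ : 0 < 1 - γ := sub_pos.2 hγ1
  set A := D * (2 ^ (1 - γ) / (1 - γ)) + p 0 + 1
  have hA : 0 < A := by have := h0 0; positivity
  refine ⟨c / (2 * A), by positivity, fun m hm => ?_⟩
  have hm0 : (0 : ℝ) < m := by exact_mod_cast hm
  have hpow : 1 ≤ (m : ℝ) ^ (1 - γ) := Real.one_le_rpow (by exact_mod_cast hm) hγ.le
  have hA_sum : ∑ k ∈ Finset.range (2 * m + 1), p k ≤ A * (m : ℝ) ^ (1 - γ) :=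
    calc ∑ k ∈ Finset.range (2 * m + 1), p k
        ≤ D * (((2 * m : ℕ) : ℝ) ^ (1 - γ) / (1 - γ)) + p 0 :=
          sum_range_succ_le_of_le_rpow_neg hγ0 hγ1 hD hle (2 * m)
      _ = D * (2 ^ (1 - γ) / (1 - γ)) * (m : ℝ) ^ (1 - γ) + p 0 := by
          push_cast
          rw [Real.mul_rpow zero_le_two hm0.le]
          ring
      _ ≤ A * (m : ℝ) ^ (1 - γ) := by nlinarith [h0 0]
  have hsplit : (m : ℝ) ^ (1 - 2 * γ) = (m : ℝ) ^ (-γ) * (m : ℝ) ^ (1 - γ) := by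
    rw [← Real.rpow_add hm0]
    congr 1
    ring
  rw [div_mul_eq_mul_div, div_le_iff₀ (by positivity)]
  refine le_of_mul_le_mul_right ?_ (zero_lt_one.trans_le hpow)
  calc c * (m : ℝ) ^ (-γ) * (m : ℝ) ^ (1 - γ) = c * (m : ℝ) ^ (1 - 2 * γ) := by
        rw [hsplit, mul_assoc]
    _ ≤ 2 * p m * ∑ k ∈ Finset.range (2 * m + 1), p k :=
        (hsum m hm).trans (sum_range_mul_sub_le_of_antitone hp h0 m)
    _ ≤ 2 * p m * (A * (m : ℝ) ^ (1 - γ)) :=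
        mul_le_mul_of_nonneg_left hA_sum (mul_nonneg zero_le_two (h0 m))
    _ = p m * (2 * A) * (m : ℝ) ^ (1 - γ) := by ring

lemma le_sqrt_mul_rpow_of_sq_le (hp : Antitone p) (h0 : ∀ k, 0 ≤ p k) {b E : ℝ} (hb : b ≤ 1)
    (hsq : ∀ m : ℕ, p (2 * m) ^ 2 ≤ E * ((m : ℝ) + 1) ^ (b - 1)) {n : ℕ} (hn : 1 ≤ n) :
    p n ≤ √(E * 2 ^ (1 - b)) * (n : ℝ) ^ (-((1 - b) / 2)) := by
  have hn0 : (0 : ℝ) < n := by exact_mod_cast hn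
  have hE : 0 ≤ E := by simpa using (sq_nonneg (p 0)).trans (hsq 0)
  have hhalf : (n : ℝ) / 2 ≤ (n / 2 : ℕ) + 1 := by
    rw [div_le_iff₀ zero_lt_two]
    exact_mod_cast (by omega : n ≤ (n / 2 + 1) * 2)
  have hsqrt : √((n : ℝ) ^ (b - 1)) = (n : ℝ) ^ (-((1 - b) / 2)) := by
    rw [Real.sqrt_eq_rpow, ← Real.rpow_mul hn0.le]
    congr 1
    ring
  rw [← hsqrt, ← Real.sqrt_mul (by positivity)]
  refine Real.le_sqrt_of_sq_le ?_
  calc p n ^ 2 ≤ p (2 * (n / 2)) ^ 2 := pow_le_pow_left₀ (h0 n) (hp (by omega)) 2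
    _ ≤ E * ((n / 2 : ℕ) + 1) ^ (b - 1) := hsq (n / 2)
    _ ≤ E * ((n : ℝ) / 2) ^ (b - 1) := mul_le_mul_of_nonneg_left
        (Real.rpow_le_rpow_of_nonpos (by positivity) hhalf (by linarith)) hE
    _ = E * 2 ^ (1 - b) * (n : ℝ) ^ (b - 1) := by
        rw [Real.div_rpow hn0.le zero_le_two, ← neg_sub 1 b, Real.rpow_neg zero_le_two]
        field_simp

end RegularVariation

lemma SameOrder.symm {a b : ℕ → ℝ} (h : SameOrder a b) : SameOrder b a := by
  obtain ⟨C₁, hC₁, C₂, hC₂, hab⟩ := h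
  refine ⟨C₂⁻¹, inv_pos.2 hC₂, C₁⁻¹, inv_pos.2 hC₁, fun n hn => ⟨?_, ?_⟩⟩
  · exact (inv_mul_le_iff₀ hC₂).2 (hab n hn).2
  · exact (le_inv_mul_iff₀ hC₁).2 (hab n hn).1

section Persistence

variable {Ω : Type*} [MeasurableSpace Ω] {P : Measure Ω} {X : ℕ → Ω → ℝ}

lemma persistenceProb_nonneg (n : ℕ) : 0 ≤ persistenceProb P X n :=
  measureReal_nonneg

namespace IsIIDSeq

lemma sq_persistenceProb_mul_le [IsFiniteMeasure P] (h : IsIIDSeq P X)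
    (hi : Integrable (X 0) P) {b C : ℝ} (hb : 0 ≤ b)
    (hC : ∀ n : ℕ, 1 ≤ n → ∫ ω, |partialSum X n ω| ∂P ≤ C * (n : ℝ) ^ b) (m : ℕ) :
    persistenceProb P X (2 * m) ^ 2 * ∫ ω, (X 0 ω)⁻ ∂P ≤
      6 * C * 3 ^ b * ((m : ℝ) + 1) ^ (b - 1) := by
  have hm : (0 : ℝ) < m + 1 := by positivity
  set p := persistenceProb P X
  set ν := ∫ ω, (X 0 ω)⁻ ∂P
  have hν : 0 ≤ ν := integral_nonneg fun _ => negPart_nonneg _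
  have hC0 : 0 ≤ C := by
    simpa using (integral_nonneg fun ω => abs_nonneg (partialSum X 1 ω)).trans (hC 1 le_rfl)
  have hS (j : ℕ) (hj : j ∈ Finset.range (3 * m + 3)) :
      ∫ ω, |partialSum X j ω| ∂P ≤ C * (3 * ((m : ℝ) + 1)) ^ b := by
    rw [Finset.mem_range] at hj
    rcases Nat.eq_zero_or_pos j with rfl | hj0
    · simp only [partialSum, Finset.range_zero, Finset.sum_empty, abs_zero, integral_zero]
      positivity
    · refine (hC j hj0).trans ?_
      gcongr
      exact_mod_cast (by omega : j ≤ 3 * (m + 1))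
  refine le_of_mul_le_mul_left ?_ hm
  calc ((m : ℝ) + 1) * (p (2 * m) ^ 2 * ν)
      = ∑ _a ∈ Finset.Icc m (2 * m), p (2 * m) ^ 2 * ν := by
        rw [Finset.sum_const, Nat.card_Icc, (by omega : 2 * m + 1 - m = m + 1), nsmul_eq_mul]
        push_cast
        rfl
    _ ≤ ∑ a ∈ Finset.Icc m (2 * m), p a * p (3 * m - a) * ν := by
        refine Finset.sum_le_sum fun a ha => mul_le_mul_of_nonneg_right ?_ hν
        rw [Finset.mem_Icc] at ha
        rw [sq]
        exact mul_le_mul (persistenceProb_antitone ha.2) (persistenceProb_antitone (by omega))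
          (persistenceProb_nonneg _) (persistenceProb_nonneg _)
    _ ≤ 2 / (m + 1) * ∑ j ∈ Finset.range (3 * m + 3), ∫ ω, |partialSum X j ω| ∂P :=
        h.sum_persistenceProb_mul_le hi m
    _ ≤ 2 / (m + 1) * ∑ _j ∈ Finset.range (3 * m + 3), C * (3 * ((m : ℝ) + 1)) ^ b :=
        mul_le_mul_of_nonneg_left (Finset.sum_le_sum hS) (by positivity)
    _ = (m + 1) * (6 * C * 3 ^ b * ((m : ℝ) + 1) ^ (b - 1)) := by
        rw [Finset.sum_const, Finset.card_range, nsmul_eq_mul, Real.mul_rpow zero_le_three hm.le,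
          Real.rpow_sub_one hm.ne']
        push_cast
        field_simp
        ring

lemma exists_integral_abs_partialSum_le_mul_sum [IsFiniteMeasure P] (h : IsIIDSeq P X)
    (hi : Integrable (X 0) P) (h0 : ∫ ω, X 0 ω ∂P = 0) {B : ℝ} (hB : ∀ᵐ ω ∂P, -B ≤ X 0 ω)
    (hν : 0 < ∫ ω, (X 0 ω)⁻ ∂P) :
    ∃ K > 0, ∀ n, ∫ ω, |partialSum X (n + 1) ω| ∂P ≤
      K * ∑ a ∈ Finset.range (n + 1), persistenceProb P X a * persistenceProb P X (n - a) := by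
  obtain ⟨K, hK, hbelow⟩ :=
    h.exists_measureReal_belowUpTo_le (measure_neg_ne_zero_of_integral_negPart_pos hν) B
  set ν := ∫ ω, (X 0 ω)⁻ ∂P
  refine ⟨2 * K ^ 2 * ν, by positivity, fun n => ?_⟩
  calc ∫ ω, |partialSum X (n + 1) ω| ∂P
      ≤ 2 * (∑ a ∈ Finset.range (n + 1), P.real {ω | BelowUpTo B a (X · ω)} *
          P.real {ω | BelowUpTo B (n - a) (X · ω)} * ν) :=
        h.integral_abs_partialSum_le_sum_belowUpTo hi h0 hB n
    _ ≤ 2 * (∑ a ∈ Finset.range (n + 1), K * persistenceProb P X a *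
          (K * persistenceProb P X (n - a)) * ν) := by
        gcongr
        · exact mul_nonneg hK.le (persistenceProb_nonneg _)
        · exact hbelow _
        · exact hbelow _
    _ = _ := by
        simp only [Finset.mul_sum]
        exact Finset.sum_congr rfl fun a _ => by ring

theorem sameOrder_persistenceProb [IsProbabilityMeasure P] (h : IsIIDSeq P X)
    (hi : Integrable (X 0) P) (h0 : ∫ ω, X 0 ω ∂P = 0) {B : ℝ} (hB : ∀ᵐ ω ∂P, -B ≤ X 0 ω)
    {b : ℝ} (hb0 : 0 ≤ b) (hb1 : b ≤ 1)
    (hE : SameOrder (fun n => ∫ ω, |partialSum X n ω| ∂P) fun n => (n : ℝ) ^ b) :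
    SameOrder (fun n => persistenceProb P X n) fun n => (n : ℝ) ^ (-((1 - b) / 2)) := by
  obtain ⟨c, hc, C, -, hcC⟩ := hE.symm
  have hν : 0 < ∫ ω, (X 0 ω)⁻ ∂P := by
    have hpos : 0 < ∫ ω, |X 0 ω| ∂P := hc.trans_le (by simpa [partialSum] using (hcC 1 le_rfl).1)
    linarith [integral_abs_eq_two_mul_integral_negPart hi h0]
  have hanti : Antitone (persistenceProb P X) := persistenceProb_antitone
  have hupper (n : ℕ) (hn : 1 ≤ n) := le_sqrt_mul_rpow_of_sq_le hanti persistenceProb_nonneg hb1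
    (E := 6 * C * 3 ^ b / ∫ ω, (X 0 ω)⁻ ∂P) (fun m => by
      rw [div_mul_eq_mul_div, le_div_iff₀ hν]
      exact h.sq_persistenceProb_mul_le hi hb0 (fun n hn => (hcC n hn).2) m) hn
  set D := √(6 * C * 3 ^ b / (∫ ω, (X 0 ω)⁻ ∂P) * 2 ^ (1 - b))
  obtain ⟨K, hK, hsum⟩ := h.exists_integral_abs_partialSum_le_mul_sum hi h0 hB hν
  obtain ⟨c', hc', hlower⟩ := exists_mul_rpow_neg_le_of_le_sum_mul hanti persistenceProb_nonneg
    (γ := (1 - b) / 2) (c := c / K) (by linarith) (by linarith) (by positivity)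
    (Real.sqrt_nonneg _) hupper fun m _ => by
      rw [div_mul_eq_mul_div, div_le_iff₀' hK, mul_div_cancel₀ _ two_ne_zero, sub_sub_cancel]
      refine le_trans ?_ (((hcC (2 * m + 1) (by omega)).1).trans (hsum (2 * m)))
      have hm : (m : ℝ) ≤ (2 * m + 1 : ℕ) := by exact_mod_cast (by omega : m ≤ 2 * m + 1)
      exact mul_le_mul_of_nonneg_left (Real.rpow_le_rpow m.cast_nonneg hm hb0) hc.le
  have hD : 0 < D := hc'.trans_le (by simpa using (hlower 1 le_rfl).trans (hupper 1 le_rfl))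
  exact SameOrder.symm ⟨c', hc', D, hD, fun n hn => ⟨hlower n hn, hupper n hn⟩⟩

end IsIIDSeq

end Persistence

/-! ### First absolute moments and characteristic functions -/

section HalfLine

lemma integrableOn_Ioi_min_rpow {a b : ℝ} (ha : -1 < a) (hb : b < -1) :
    IntegrableOn (fun u : ℝ => min (u ^ a) (u ^ b)) (Set.Ioi 0) := by
  have hmeas : Measurable fun u : ℝ => min (u ^ a) (u ^ b) := by fun_prop
  have hnonneg (u : ℝ) (hu : 0 < u) : 0 ≤ min (u ^ a) (u ^ b) := by positivity
  have hsmall : IntegrableOn (fun u : ℝ => u ^ a) (Set.Ioc 0 1) :=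
    (intervalIntegrable_iff_integrableOn_Ioc_of_le zero_le_one).1
      (intervalIntegral.intervalIntegrable_rpow' ha)
  have hlarge : IntegrableOn (fun u : ℝ => u ^ b) (Set.Ioi 1) :=
    integrableOn_Ioi_rpow_of_lt hb one_pos
  rw [← Set.Ioc_union_Ioi_eq_Ioi zero_le_one]
  refine .union (hsmall.mono' hmeas.aestronglyMeasurable ?_)
    (hlarge.mono' hmeas.aestronglyMeasurable ?_)
  · filter_upwards [ae_restrict_mem measurableSet_Ioc] with u hu
    rw [Real.norm_of_nonneg (hnonneg u hu.1)]
    exact min_le_left _ _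
  · filter_upwards [ae_restrict_mem measurableSet_Ioi] with u hu
    rw [Real.norm_of_nonneg (hnonneg u (one_pos.trans hu))]
    exact min_le_right _ _

lemma integrableOn_Ioi_of_norm_le_rpow {E : Type*} [NormedAddCommGroup E] {a b C : ℝ} {g : ℝ → E}
    (ha : -1 < a) (hb : b < -1) (hg : AEStronglyMeasurable g (volume.restrict (Set.Ioi 0)))
    (hga : ∀ u, 0 < u → ‖g u‖ ≤ C * u ^ a) (hgb : ∀ u, 0 < u → ‖g u‖ ≤ C * u ^ b) :
    IntegrableOn g (Set.Ioi 0) := by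
  have hC : 0 ≤ C := by simpa using (norm_nonneg _).trans (hga 1 one_pos)
  refine ((integrableOn_Ioi_min_rpow ha hb).const_mul C).mono' hg ?_
  filter_upwards [ae_restrict_mem measurableSet_Ioi] with u hu
  rw [mul_min_of_nonneg _ _ hC]
  exact le_min (hga u hu) (hgb u hu)

lemma setIntegral_Ioi_pos {f : ℝ → ℝ} (hf : IntegrableOn f (Set.Ioi 0))
    (h0 : ∀ u, 0 < u → 0 ≤ f u) (h1 : ∀ u, 0 < u → u < 1 → 0 < f u) :
    0 < ∫ u in Set.Ioi 0, f u := by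
  have hae : ∀ᵐ u ∂volume.restrict (Set.Ioi 0), 0 ≤ f u := by
    filter_upwards [ae_restrict_mem measurableSet_Ioi] with u hu using h0 u hu
  have hsub : Set.Ioo 0 1 ⊆ Function.support f ∩ Set.Ioi 0 :=
    fun u hu => ⟨(h1 u hu.1 hu.2).ne', hu.1⟩
  rw [setIntegral_pos_iff_support_of_nonneg_ae hae hf]
  exact (by simp : (0 : ENNReal) < volume (Set.Ioo (0 : ℝ) 1)).trans_le (measure_mono hsub)

end HalfLine

section CosKernel

/-- The constant `∫₀^∞ (1 - cos u) / u² du`, which normalises the representation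
`|z| = cosKernel⁻¹ ∫₀^∞ (1 - cos (z u)) / u² du` of the absolute value. -/
noncomputable def cosKernel : ℝ := ∫ u in Set.Ioi (0 : ℝ), (1 - Real.cos u) / u ^ 2

lemma one_sub_cos_div_sq_nonneg (z u : ℝ) : 0 ≤ (1 - Real.cos (z * u)) / u ^ 2 :=
  div_nonneg (sub_nonneg.2 (Real.cos_le_one _)) (sq_nonneg u)

lemma integrableOn_one_sub_cos_div_sq (z : ℝ) :
    IntegrableOn (fun u : ℝ => (1 - Real.cos (z * u)) / u ^ 2) (Set.Ioi 0) := by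
  refine integrableOn_Ioi_of_norm_le_rpow (a := 0) (b := -2) (C := z ^ 2 + 2) (by norm_num)
    (by norm_num) (Measurable.aestronglyMeasurable (by fun_prop)) (fun u hu => ?_) fun u hu => ?_
  · rw [Real.norm_of_nonneg (one_sub_cos_div_sq_nonneg z u), Real.rpow_zero,
      div_le_iff₀ (by positivity)]
    nlinarith [Real.one_sub_sq_div_two_le_cos (x := z * u), sq_nonneg u, sq_nonneg (z * u)]
  · rw [Real.norm_of_nonneg (one_sub_cos_div_sq_nonneg z u), Real.rpow_neg hu.le, Real.rpow_two,
      ← div_eq_mul_inv]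
    gcongr
    linarith [Real.neg_one_le_cos (z * u), sq_nonneg z]

lemma cosKernel_pos : 0 < cosKernel := by
  refine setIntegral_Ioi_pos (by simpa using integrableOn_one_sub_cos_div_sq 1)
    (fun u _ => by simpa using one_sub_cos_div_sq_nonneg 1 u) fun u h0 h1 => ?_
  have hcos : Real.cos u < Real.cos 0 :=
    Real.cos_lt_cos_of_nonneg_of_le_pi le_rfl (by linarith [Real.pi_gt_three]) h0
  rw [Real.cos_zero] at hcos
  exact div_pos (sub_pos.2 hcos) (by positivity)

lemma integral_one_sub_cos_div_sq (z : ℝ) :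
    ∫ u in Set.Ioi (0 : ℝ), (1 - Real.cos (z * u)) / u ^ 2 = |z| * cosKernel := by
  rcases eq_or_ne z 0 with rfl | hz
  · simp
  have hz0 : 0 < |z| := abs_pos.2 hz
  have hscale : ∫ u in Set.Ioi (0 : ℝ), (1 - Real.cos (|z| * u)) / (|z| * u) ^ 2 =
      |z|⁻¹ * cosKernel :=
    (integral_comp_mul_left_Ioi (fun u : ℝ => (1 - Real.cos u) / u ^ 2) 0 hz0).trans
      (by rw [mul_zero]; rfl)
  calc ∫ u in Set.Ioi (0 : ℝ), (1 - Real.cos (z * u)) / u ^ 2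
      = ∫ u in Set.Ioi (0 : ℝ), |z| ^ 2 * ((1 - Real.cos (|z| * u)) / (|z| * u) ^ 2) := by
        refine setIntegral_congr_fun measurableSet_Ioi fun u hu => ?_
        have hu0 : 0 < u := hu
        have hcos : Real.cos (|z| * u) = Real.cos (z * u) := by
          rw [← Real.cos_abs (z * u), abs_mul, abs_of_pos hu0]
        simp only [hcos]
        field_simp
    _ = |z| * cosKernel := by
        rw [integral_const_mul, hscale]
        field_simp

variable (μ : Measure ℝ) [IsProbabilityMeasure μ]

lemma one_sub_re_charFun (t : ℝ) :
    1 - (charFun μ t).re = ∫ x, (1 - Real.cos (x * t)) ∂μ := by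
  have hexp : Integrable (fun x : ℝ => Complex.exp (t * x * Complex.I)) μ := by
    refine .of_bound (C := 1) (by fun_prop) (ae_of_all _ fun x => ?_)
    rw [← Complex.ofReal_mul, Complex.norm_exp_ofReal_mul_I]
  have hcos : Integrable (fun x => Real.cos (x * t)) μ :=
    .of_bound (C := 1) (by fun_prop) (ae_of_all _ fun x => Real.abs_cos_le_one _)
  have hre : (charFun μ t).re = ∫ x, Real.cos (x * t) ∂μ := by
    rw [charFun_apply_real]
    refine (integral_re hexp).symm.trans (integral_congr_ae (ae_of_all _ fun x => ?_))
    simp only [RCLike.re_to_complex]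
    rw [← Complex.ofReal_mul, Complex.exp_ofReal_mul_I_re, mul_comm]
  rw [integral_sub (integrable_const _) hcos, hre]
  simp

lemma integral_abs_mul_cosKernel (hμ : Integrable (fun x => x) μ) :
    (∫ x, |x| ∂μ) * cosKernel = ∫ t in Set.Ioi (0 : ℝ), (1 - (charFun μ t).re) / t ^ 2 := by
  have hprod : Integrable (Function.uncurry fun x t : ℝ => (1 - Real.cos (x * t)) / t ^ 2)
      (μ.prod (volume.restrict (Set.Ioi 0))) := by
    have hmeas : Measurable (Function.uncurry fun x t : ℝ => (1 - Real.cos (x * t)) / t ^ 2) := by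
      unfold Function.uncurry
      fun_prop
    rw [integrable_prod_iff hmeas.aestronglyMeasurable]
    refine ⟨ae_of_all _ integrableOn_one_sub_cos_div_sq, ?_⟩
    simp only [Function.uncurry_apply_pair, Real.norm_of_nonneg (one_sub_cos_div_sq_nonneg _ _),
      integral_one_sub_cos_div_sq]
    exact hμ.abs.mul_const _
  calc (∫ x, |x| ∂μ) * cosKernel
      = ∫ x, (∫ t in Set.Ioi (0 : ℝ), (1 - Real.cos (x * t)) / t ^ 2) ∂μ := by
        simp only [integral_one_sub_cos_div_sq, integral_mul_const]
    _ = ∫ t in Set.Ioi (0 : ℝ), (∫ x, (1 - Real.cos (x * t)) / t ^ 2 ∂μ) :=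
        integral_integral_swap hprod
    _ = ∫ t in Set.Ioi (0 : ℝ), (1 - (charFun μ t).re) / t ^ 2 := by
        simp only [integral_div, one_sub_re_charFun]

end CosKernel

section StableLimit

lemma norm_one_sub_pow_le {z : ℂ} (hz : ‖z‖ ≤ 1) (n : ℕ) : ‖1 - z ^ n‖ ≤ n * ‖1 - z‖ := by
  have hgeom : ‖∑ i ∈ Finset.range n, z ^ i‖ ≤ n :=
    calc ‖∑ i ∈ Finset.range n, z ^ i‖ ≤ ∑ i ∈ Finset.range n, ‖z ^ i‖ := norm_sum_le _ _
      _ ≤ ∑ _i ∈ Finset.range n, 1 := Finset.sum_le_sum fun i _ => by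
        rw [norm_pow]
        exact pow_le_one₀ (norm_nonneg z) hz
      _ = n := by simp
  rw [← geom_sum_mul_neg, norm_mul]
  exact mul_le_mul_of_nonneg_right hgeom (norm_nonneg _)

lemma norm_one_sub_re_div_sq_le {α K t : ℝ} {w : ℂ} (ht : 0 < t) (hw : ‖w‖ ≤ 1)
    (hK : ‖1 - w‖ ≤ K * t ^ α) :
    ‖(1 - w.re) / t ^ 2‖ ≤ (K + 2) * min (t ^ (α - 2)) (t ^ (-2 : ℝ)) := by
  have htα : 0 < t ^ α := by positivity
  have hK0 : 0 ≤ K := nonneg_of_mul_nonneg_left ((norm_nonneg _).trans hK) htα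
  have hre : |1 - w.re| ≤ ‖1 - w‖ := by simpa using Complex.abs_re_le_norm (1 - w)
  have htwo : ‖1 - w‖ ≤ 2 := (norm_sub_le _ _).trans (by rw [norm_one]; linarith)
  rw [norm_div, Real.norm_eq_abs, Real.norm_of_nonneg (sq_nonneg t), Real.rpow_sub ht,
    Real.rpow_neg ht.le, Real.rpow_two, ← one_div, min_div_div_right (sq_nonneg t),
    ← mul_div_assoc, mul_min_of_nonneg _ _ (by positivity)]
  gcongr
  exact le_min (by linarith) (by linarith)

/-- The first absolute moment of the stable law whose characteristic function on `(0, ∞)` is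
`t ↦ exp (t ^ α * c)`, expressed through `cosKernel`. -/
noncomputable def stableAbsMoment (α : ℝ) (c : ℂ) : ℝ :=
  (∫ t in Set.Ioi (0 : ℝ), (1 - (Complex.exp ((t ^ α : ℝ) * c)).re) / t ^ 2) / cosKernel

lemma stableAbsMoment_pos {α : ℝ} (hα : 1 < α) {c : ℂ} (hc : c.re < 0) :
    0 < stableAbsMoment α c := by
  have hnorm (t : ℝ) (ht : 0 < t) : ‖Complex.exp ((t ^ α : ℝ) * c)‖ < 1 := by
    rw [Complex.norm_exp, Complex.re_ofReal_mul, Real.exp_lt_one_iff]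
    exact mul_neg_of_pos_of_neg (by positivity) hc
  have hpos (t : ℝ) (ht : 0 < t) : 0 < (1 - (Complex.exp ((t ^ α : ℝ) * c)).re) / t ^ 2 :=
    div_pos (sub_pos.2 ((Complex.re_le_norm _).trans_lt (hnorm t ht))) (by positivity)
  have hbound (t : ℝ) (ht : 0 < t) :
      ‖1 - Complex.exp ((t ^ α : ℝ) * c)‖ ≤ 2 * ‖c‖ * t ^ α := by
    have hz : ‖((t ^ α : ℝ) : ℂ) * c‖ = t ^ α * ‖c‖ := by
      rw [norm_mul, Complex.norm_real, Real.norm_of_nonneg (by positivity)]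
    rw [norm_sub_rev, mul_assoc, mul_comm ‖c‖, ← hz]
    rcases le_total ‖((t ^ α : ℝ) : ℂ) * c‖ 1 with hle | hge
    · exact Complex.norm_exp_sub_one_le hle
    · refine (norm_sub_le _ _).trans ?_
      rw [norm_one]
      linarith [hnorm t ht]
  refine div_pos (setIntegral_Ioi_pos ?_ (fun t ht => (hpos t ht).le) fun t ht _ => hpos t ht)
    cosKernel_pos
  refine ((integrableOn_Ioi_min_rpow (by linarith : -1 < α - 2)
    (by norm_num : (-2 : ℝ) < -1)).const_mul (2 * ‖c‖ + 2)).mono'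
    (Measurable.aestronglyMeasurable (by fun_prop)) ?_
  filter_upwards [ae_restrict_mem measurableSet_Ioi] with t ht
  exact norm_one_sub_re_div_sq_le ht (hnorm t ht).le (hbound t ht)

lemma natCast_rpow_neg_one_div_mul_rpow {α : ℝ} (hα : α ≠ 0) (n : ℕ) {t : ℝ} (ht : 0 ≤ t) :
    ((n : ℝ) ^ (-(1 / α)) * t) ^ α = t ^ α / n := by
  rw [Real.mul_rpow (by positivity) ht, ← Real.rpow_mul n.cast_nonneg, neg_mul,
    one_div_mul_cancel hα, Real.rpow_neg_one, inv_mul_eq_div]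

variable {μ : Measure ℝ} {α : ℝ} {c : ℂ}

lemma tendsto_charFun_pow (hα : 0 < α)
    (hμ : Tendsto (fun t : ℝ => (t ^ α)⁻¹ • (charFun μ t - 1)) (𝓝[>] 0) (𝓝 c)) {t : ℝ}
    (ht : 0 < t) :
    Tendsto (fun n : ℕ => charFun μ ((n : ℝ) ^ (-(1 / α)) * t) ^ n) atTop
      (𝓝 (Complex.exp ((t ^ α : ℝ) * c))) := by
  have hscale : Tendsto (fun n : ℕ => (n : ℝ) ^ (-(1 / α)) * t) atTop (𝓝[>] 0) := by
    refine tendsto_nhdsWithin_iff.2 ⟨?_, ?_⟩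
    · simpa using ((tendsto_rpow_neg_atTop (by positivity : 0 < 1 / α)).comp
        tendsto_natCast_atTop_atTop).mul_const t
    · filter_upwards [eventually_gt_atTop 0] with n hn
      exact mul_pos (Real.rpow_pos_of_pos (by exact_mod_cast hn) _) ht
  have hlim : Tendsto (fun n : ℕ => (n : ℂ) * (charFun μ ((n : ℝ) ^ (-(1 / α)) * t) - 1)) atTop
      (𝓝 ((t ^ α : ℝ) * c)) := by
    refine ((hμ.comp hscale).const_mul ((t ^ α : ℝ) : ℂ)).congr fun n => ?_
    have htα : ((t ^ α : ℝ) : ℂ) ≠ 0 := by exact_mod_cast (by positivity : t ^ α ≠ 0)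
    rw [Function.comp_apply, natCast_rpow_neg_one_div_mul_rpow hα.ne' n ht.le, inv_div,
      Complex.real_smul, Complex.ofReal_div, Complex.ofReal_natCast]
    field_simp
  simpa using Complex.tendsto_one_add_pow_exp_of_tendsto hlim

variable [IsProbabilityMeasure μ]

lemma exists_norm_one_sub_charFun_le (hα : 0 < α)
    (hμ : Tendsto (fun t : ℝ => (t ^ α)⁻¹ • (charFun μ t - 1)) (𝓝[>] 0) (𝓝 c)) :
    ∃ K, ∀ t, 0 < t → ‖1 - charFun μ t‖ ≤ K * t ^ α := by
  have hnear : ∀ᶠ t : ℝ in 𝓝[>] 0, ‖(t ^ α)⁻¹ • (charFun μ t - 1)‖ < ‖c‖ + 1 :=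
    hμ.norm.eventually_lt_const (lt_add_one _)
  obtain ⟨δ, hδ, hsub⟩ := mem_nhdsGT_iff_exists_Ioo_subset.1 hnear
  have hδ0 : (0 : ℝ) < δ := hδ
  refine ⟨max (‖c‖ + 1) (2 / δ ^ α), fun t ht => ?_⟩
  have htα : 0 < t ^ α := by positivity
  rcases lt_or_ge t δ with hlt | hge
  · have hbound : ‖(t ^ α)⁻¹ • (charFun μ t - 1)‖ < ‖c‖ + 1 := hsub ⟨ht, hlt⟩
    rw [norm_smul, norm_inv, Real.norm_of_nonneg htα.le, inv_mul_lt_iff₀ htα] at hbound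
    rw [norm_sub_rev, mul_comm]
    exact hbound.le.trans (mul_le_mul_of_nonneg_left (le_max_left _ _) htα.le)
  · calc ‖1 - charFun μ t‖ ≤ ‖(1 : ℂ)‖ + ‖charFun μ t‖ := norm_sub_le _ _
      _ ≤ 2 := by rw [norm_one]; linarith [norm_charFun_le_one (μ := μ) t]
      _ = 2 / δ ^ α * δ ^ α := (div_mul_cancel₀ _ (by positivity)).symm
      _ ≤ max (‖c‖ + 1) (2 / δ ^ α) * t ^ α := by
        gcongr
        exact le_max_right _ _

lemma tendsto_integral_one_sub_re_charFun_pow (hα : 1 < α)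
    (hμ : Tendsto (fun t : ℝ => (t ^ α)⁻¹ • (charFun μ t - 1)) (𝓝[>] 0) (𝓝 c)) :
    Tendsto (fun n : ℕ => ∫ t in Set.Ioi (0 : ℝ),
        (1 - (charFun μ ((n : ℝ) ^ (-(1 / α)) * t) ^ n).re) / t ^ 2) atTop
      (𝓝 (∫ t in Set.Ioi (0 : ℝ), (1 - (Complex.exp ((t ^ α : ℝ) * c)).re) / t ^ 2)) := by
  have hα0 : 0 < α := one_pos.trans hα
  obtain ⟨K, hK⟩ := exists_norm_one_sub_charFun_le hα0 hμ
  have hbound (n : ℕ) {t : ℝ} (ht : 0 < t) :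
      ‖1 - charFun μ ((n : ℝ) ^ (-(1 / α)) * t) ^ n‖ ≤ K * t ^ α := by
    rcases n.eq_zero_or_pos with rfl | hn
    · simpa using (norm_nonneg _).trans (hK t ht)
    have hn0 : (n : ℝ) ≠ 0 := by exact_mod_cast hn.ne'
    have hscale : 0 < (n : ℝ) ^ (-(1 / α)) * t :=
      mul_pos (Real.rpow_pos_of_pos (by exact_mod_cast hn) _) ht
    calc ‖1 - charFun μ ((n : ℝ) ^ (-(1 / α)) * t) ^ n‖
        ≤ n * ‖1 - charFun μ ((n : ℝ) ^ (-(1 / α)) * t)‖ :=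
          norm_one_sub_pow_le (norm_charFun_le_one _) n
      _ ≤ n * (K * ((n : ℝ) ^ (-(1 / α)) * t) ^ α) := by
          gcongr
          exact hK _ hscale
      _ = K * t ^ α := by
          rw [natCast_rpow_neg_one_div_mul_rpow hα0.ne' n ht.le]
          exact mul_div_assoc' K _ _ ▸ mul_div_cancel₀ _ hn0
  refine tendsto_integral_of_dominated_convergence
    (fun t => (K + 2) * min (t ^ (α - 2)) (t ^ (-2 : ℝ))) (fun n => ?_)
    ((integrableOn_Ioi_min_rpow (by linarith) (by norm_num)).const_mul _) (fun n => ?_) ?_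
  · have : Measurable (charFun μ) := measurable_charFun
    exact Measurable.aestronglyMeasurable (by fun_prop)
  · filter_upwards [ae_restrict_mem measurableSet_Ioi] with t ht
    refine norm_one_sub_re_div_sq_le ht ?_ (hbound n ht)
    rw [norm_pow]
    exact pow_le_one₀ (norm_nonneg _) (norm_charFun_le_one _)
  · filter_upwards [ae_restrict_mem measurableSet_Ioi] with t ht
    exact (((Complex.continuous_re.tendsto _).comp
      (tendsto_charFun_pow hα0 hμ ht)).const_sub 1).div_const _

end StableLimit

lemma sameOrder_of_tendsto {a : ℕ → ℝ} {b L : ℝ} (hL : L ≠ 0) (ha : ∀ n, 1 ≤ n → 0 < a n)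
    (h : Tendsto (fun n : ℕ => (n : ℝ) ^ (-b) * a n) atTop (𝓝 L)) :
    SameOrder a fun n => (n : ℝ) ^ b := by
  obtain ⟨M, hM⟩ := h.bddAbove_range
  obtain ⟨M', hM'⟩ := (h.inv₀ hL).bddAbove_range
  have hle (n : ℕ) : (n : ℝ) ^ (-b) * a n ≤ M := hM ⟨n, rfl⟩
  have hinv_le (n : ℕ) : ((n : ℝ) ^ (-b) * a n)⁻¹ ≤ M' := hM' ⟨n, rfl⟩
  have hone : 0 < ((1 : ℕ) : ℝ) ^ (-b) * a 1 := by simpa using ha 1 le_rfl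
  have hM0 : 0 < M := hone.trans_le (hle 1)
  refine ⟨M⁻¹, inv_pos.2 hM0, M', (inv_pos.2 hone).trans_le (hinv_le 1), fun n hn => ?_⟩
  have hn0 : (0 : ℝ) < n := by exact_mod_cast hn
  have hnb : (0 : ℝ) < (n : ℝ) ^ b := by positivity
  have hle_n := hle n
  have hinv_n := hinv_le n
  rw [Real.rpow_neg hn0.le, inv_mul_eq_div] at hle_n hinv_n
  rw [inv_div, div_le_iff₀ (ha n hn)] at hinv_n
  exact ⟨(inv_mul_le_iff₀ hM0).2 ((div_le_iff₀ hnb).1 hle_n), hinv_n⟩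

section AbsMoment

variable {Ω : Type*} [MeasurableSpace Ω] {P : Measure Ω} {X : ℕ → Ω → ℝ}

namespace IsIIDSeq

lemma measurable_partialSum (h : IsIIDSeq P X) (n : ℕ) : Measurable (partialSum X n) :=
  Finset.measurable_fun_sum _ fun i _ => h.measurable i

lemma charFun_partialSum [IsFiniteMeasure P] (h : IsIIDSeq P X) (n : ℕ) (t : ℝ) :
    charFun (P.map (partialSum X n)) t = charFun (P.map (X 0)) t ^ n := by
  have hprod := iIndepFun.charFun_map_fun_finsetSum_eq_prod (P := P) (s := Finset.range n)
    (fun i _ => (h.measurable i).aemeasurable) (h.indep.restrict _)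
  have hsum : partialSum X n = fun ω => ∑ i ∈ Finset.range n, X i ω := rfl
  rw [hsum, hprod, Finset.prod_apply]
  simp [fun i => (h.identDistrib i).map_eq]

lemma mul_integral_abs_partialSum_mul_cosKernel [IsProbabilityMeasure P] (h : IsIIDSeq P X)
    (hi : Integrable (X 0) P) {s : ℝ} (hs : 0 ≤ s) (n : ℕ) :
    s * (∫ ω, |partialSum X n ω| ∂P) * cosKernel =
      ∫ t in Set.Ioi (0 : ℝ), (1 - (charFun (P.map (X 0)) (s * t) ^ n).re) / t ^ 2 := by
  have hmeas : Measurable fun ω => s * partialSum X n ω := (h.measurable_partialSum n).const_mul s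
  have := Measure.isProbabilityMeasure_map (μ := P) hmeas.aemeasurable
  have hint : Integrable (fun x => x) (P.map fun ω => s * partialSum X n ω) :=
    (integrable_map_measure (by fun_prop) hmeas.aemeasurable).2
      ((h.integrable_partialSum hi n).const_mul s)
  have habs : ∫ x, |x| ∂(P.map fun ω => s * partialSum X n ω) =
      s * ∫ ω, |partialSum X n ω| ∂P := by
    rw [integral_map hmeas.aemeasurable (by fun_prop), ← integral_const_mul]
    simp only [abs_mul, abs_of_nonneg hs]
  rw [← habs, integral_abs_mul_cosKernel _ hint]
  simp only [charFun_map_mul_comp (h.measurable_partialSum n).aemeasurable, h.charFun_partialSum]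

theorem tendsto_integral_abs_partialSum [IsProbabilityMeasure P] (h : IsIIDSeq P X)
    (hi : Integrable (X 0) P) {α : ℝ} (hα : 1 < α) {c : ℂ}
    (hφ : Tendsto (fun t : ℝ => (t ^ α)⁻¹ • (charFun (P.map (X 0)) t - 1)) (𝓝[>] 0) (𝓝 c)) :
    Tendsto (fun n : ℕ => (n : ℝ) ^ (-(1 / α)) * ∫ ω, |partialSum X n ω| ∂P) atTop
      (𝓝 (stableAbsMoment α c)) := by
  have := Measure.isProbabilityMeasure_map (μ := P) (h.measurable 0).aemeasurable
  refine ((tendsto_integral_one_sub_re_charFun_pow hα hφ).div_const cosKernel).congr fun n => ?_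
  rw [← h.mul_integral_abs_partialSum_mul_cosKernel hi (by positivity),
    mul_div_cancel_right₀ _ cosKernel_pos.ne']

lemma integral_abs_partialSum_pos [IsFiniteMeasure P] (h : IsIIDSeq P X)
    (hi : Integrable (X 0) P) (hneg : P {ω | X 0 ω < 0} ≠ 0) {n : ℕ} (hn : 1 ≤ n) :
    0 < ∫ ω, |partialSum X n ω| ∂P := by
  refine (integral_nonneg fun ω => abs_nonneg _).lt_of_ne' fun hzero => ?_
  have hae : partialSum X n =ᵐ[P] 0 :=
    ((integral_eq_zero_iff_of_nonneg (fun ω => abs_nonneg (partialSum X n ω))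
      (h.integrable_partialSum hi n).abs).1 hzero).mono fun ω hω => abs_eq_zero.1 hω
  have hsub : {ω | ∀ i < n, X i ω ∈ Set.Iio 0} ⊆ {ω | partialSum X n ω ≠ 0} := fun ω hω =>
    (Finset.sum_neg (fun i hi => hω i (Finset.mem_range.1 hi)) ⟨0, Finset.mem_range.2 hn⟩).ne
  have hnull : P.real {ω | ∀ i < n, X i ω ∈ Set.Iio 0} = 0 := by
    rw [measureReal_def, measure_mono_null hsub (ae_iff.1 hae), ENNReal.toReal_zero]
  rw [h.measureReal_forall_lt_mem n measurableSet_Iio] at hnull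
  exact hneg ((measureReal_eq_zero_iff).1 (pow_eq_zero_iff (by omega) |>.1 hnull))

theorem sameOrder_integral_abs_partialSum [IsFiniteMeasure P] (h : IsIIDSeq P X)
    (hi : Integrable (X 0) P) (h0 : ∫ ω, X 0 ω ∂P = 0) {b L : ℝ} (hL : L ≠ 0)
    (hlim : Tendsto (fun n : ℕ => (n : ℝ) ^ (-b) * ∫ ω, |partialSum X n ω| ∂P) atTop (𝓝 L)) :
    SameOrder (fun n => ∫ ω, |partialSum X n ω| ∂P) fun n => (n : ℝ) ^ b := by
  have hν : 0 < ∫ ω, (X 0 ω)⁻ ∂P := by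
    refine (integral_nonneg fun _ => negPart_nonneg _).lt_of_ne' fun hzero => hL ?_
    have hS (n : ℕ) : ∫ ω, |partialSum X n ω| ∂P = 0 := by
      refine le_antisymm ((h.integral_abs_partialSum_le hi n).trans_eq ?_)
        (integral_nonneg fun _ => abs_nonneg _)
      rw [integral_abs_eq_two_mul_integral_negPart hi h0, hzero, mul_zero, mul_zero]
    simp only [hS, mul_zero] at hlim
    exact tendsto_nhds_unique hlim tendsto_const_nhds
  exact sameOrder_of_tendsto hL (fun n hn => h.integral_abs_partialSum_pos hi
    (measure_neg_ne_zero_of_integral_negPart_pos hν) hn) hlim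

end IsIIDSeq

end AbsMoment

/-! ### Pareto distributions -/

section Pareto

variable {t r : ℝ}

lemma paretoMeasure_eq_withDensity (t r : ℝ) :
    paretoMeasure t r = (volume.restrict (Set.Ioi t)).withDensity
      fun y => ENNReal.ofReal (r * t ^ r * y ^ (-(r + 1))) := by
  have hpdf : paretoPDF t r = (Set.Ici t).indicator
      fun y => ENNReal.ofReal (r * t ^ r * y ^ (-(r + 1))) := by
    ext y
    rcases le_or_gt t y with hy | hy
    · rw [paretoPDF_of_le hy, Set.indicator_of_mem (Set.mem_Ici.2 hy)]
    · rw [paretoPDF_of_lt hy, Set.indicator_of_notMem (Set.notMem_Ici.2 hy)]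
  rw [paretoMeasure, hpdf, withDensity_indicator measurableSet_Ici,
    Measure.restrict_congr_set Ioi_ae_eq_Ici]

lemma ae_paretoMeasure_lt (t r : ℝ) : ∀ᵐ y ∂paretoMeasure t r, t < y := by
  rw [paretoMeasure_eq_withDensity]
  exact (withDensity_absolutelyContinuous _ _).ae_le (ae_restrict_mem measurableSet_Ioi)

lemma ae_toReal_paretoDensity (ht : 0 < t) (hr : 0 < r) :
    ∀ᵐ y ∂volume.restrict (Set.Ioi t),
      (ENNReal.ofReal (r * t ^ r * y ^ (-(r + 1)))).toReal = r * t ^ r * y ^ (-(r + 1)) := by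
  filter_upwards [ae_restrict_mem measurableSet_Ioi] with y hy
  have hy0 : 0 < y := ht.trans hy
  exact ENNReal.toReal_ofReal (by positivity)

variable {E : Type*} [NormedAddCommGroup E] [NormedSpace ℝ E]

lemma integrable_paretoMeasure_iff (ht : 0 < t) (hr : 0 < r) (f : ℝ → E) :
    Integrable f (paretoMeasure t r) ↔
      IntegrableOn (fun y => (r * t ^ r * y ^ (-(r + 1))) • f y) (Set.Ioi t) := by
  rw [paretoMeasure_eq_withDensity, integrable_withDensity_iff_integrable_smul' (by fun_prop)
    (ae_of_all _ fun _ => ENNReal.ofReal_lt_top)]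
  refine integrable_congr ?_
  filter_upwards [ae_toReal_paretoDensity ht hr] with y hy
  rw [hy]

lemma integral_paretoMeasure (ht : 0 < t) (hr : 0 < r) (f : ℝ → E) :
    ∫ y, f y ∂paretoMeasure t r =
      ∫ y in Set.Ioi t, (r * t ^ r * y ^ (-(r + 1))) • f y := by
  rw [paretoMeasure_eq_withDensity, integral_withDensity_eq_integral_toReal_smul (by fun_prop)
    (ae_of_all _ fun _ => ENNReal.ofReal_lt_top)]
  refine integral_congr_ae ?_
  filter_upwards [ae_toReal_paretoDensity ht hr] with y hy
  rw [hy]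

lemma rpow_neg_add_one_mul_self {y : ℝ} (hy : 0 < y) (r : ℝ) : y ^ (-(r + 1)) * y = y ^ (-r) := by
  rw [← Real.rpow_add_one hy.ne', neg_add, neg_add_cancel_right]

lemma integrable_id_paretoMeasure (ht : 0 < t) (hr : 1 < r) :
    Integrable (fun y => y) (paretoMeasure t r) := by
  rw [integrable_paretoMeasure_iff ht (one_pos.trans hr)]
  refine ((integrableOn_Ioi_rpow_of_lt (neg_lt_neg hr) ht).const_mul (r * t ^ r)).congr ?_
  filter_upwards [ae_restrict_mem measurableSet_Ioi] with y hy
  rw [smul_eq_mul, mul_assoc (r * t ^ r), rpow_neg_add_one_mul_self (ht.trans hy)]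

lemma paretoMeasure_real_Ioi (ht : 0 < t) (hr : 0 < r) {y : ℝ} (hy : t ≤ y) :
    (paretoMeasure t r).real (Set.Ioi y) = (t / y) ^ r := by
  have hy0 : 0 < y := ht.trans_le hy
  have hind (u : ℝ) : (r * t ^ r * u ^ (-(r + 1))) • (Set.Ioi y).indicator (1 : ℝ → ℝ) u =
      (Set.Ioi y).indicator (fun u => r * t ^ r * u ^ (-(r + 1))) u := by
    by_cases hu : u ∈ Set.Ioi y <;> simp [hu]
  rw [← integral_indicator_one measurableSet_Ioi, integral_paretoMeasure ht hr]
  simp only [hind]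
  rw [setIntegral_indicator measurableSet_Ioi, Set.inter_eq_right.2 (Set.Ioi_subset_Ioi hy),
    integral_const_mul, integral_Ioi_rpow_of_lt (by linarith) hy0, Real.div_rpow ht.le hy0.le,
    neg_add, neg_add_cancel_right, Real.rpow_neg hy0.le]
  field_simp

lemma eq_paretoMeasure (ht : 0 < t) (hr : 0 < r) {μ : Measure ℝ} [IsProbabilityMeasure μ]
    (hμ : ∀ y, t ≤ y → μ.real (Set.Ioi y) = (t / y) ^ r) : μ = paretoMeasure t r := by
  have := isProbabilityMeasure_paretoMeasure ht hr
  have htail {ν : Measure ℝ} [IsProbabilityMeasure ν]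
      (hν : ∀ y, t ≤ y → ν.real (Set.Ioi y) = (t / y) ^ r) (y : ℝ) :
      ν.real (Set.Ioi y) = (t / max t y) ^ r := by
    rcases le_total t y with hy | hy
    · rw [hν y hy, max_eq_right hy]
    · have hone : ν.real (Set.Ioi t) = 1 := by rw [hν t le_rfl, div_self ht.ne', Real.one_rpow]
      rw [max_eq_left hy, ← hν t le_rfl]
      exact le_antisymm (measureReal_le_one.trans_eq hone.symm)
        (measureReal_mono (Set.Ioi_subset_Ioi hy))
  refine Measure.ext_of_Iic _ _ fun a => ?_
  rw [← measureReal_eq_measureReal_iff, ← Set.compl_Ioi,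
    probReal_compl_eq_one_sub measurableSet_Ioi, probReal_compl_eq_one_sub measurableSet_Ioi,
    htail hμ, htail fun y hy => paretoMeasure_real_Ioi ht hr hy]

lemma map_const_mul_paretoMeasure {s : ℝ} (hs : 0 < s) (ht : 0 < t) (hr : 0 < r) :
    (paretoMeasure t r).map (s * ·) = paretoMeasure (s * t) r := by
  have := isProbabilityMeasure_paretoMeasure ht hr
  have := Measure.isProbabilityMeasure_map (μ := paretoMeasure t r) (f := (s * ·)) (by fun_prop)
  refine eq_paretoMeasure (mul_pos hs ht) hr fun y hy => ?_
  rw [map_measureReal_apply (by fun_prop) measurableSet_Ioi, Set.preimage_const_mul_Ioi₀ _ hs,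
    paretoMeasure_real_Ioi ht hr ((le_div_iff₀' hs).2 hy), div_div_eq_mul_div, mul_comm]

end Pareto

section CharFunRemainder

/-- The second order Taylor remainder of `x ↦ exp (x * I)` at `0`: the integrand of the Lévy
exponent of a centred stable law. -/
noncomputable def expRem (x : ℝ) : ℂ := Complex.exp (x * Complex.I) - 1 - x * Complex.I

@[fun_prop]
lemma continuous_expRem : Continuous expRem := by
  unfold expRem
  fun_prop

lemma re_expRem (x : ℝ) : (expRem x).re = Real.cos x - 1 := by
  simp [expRem, Complex.exp_ofReal_mul_I_re]

lemma norm_expRem_le (x : ℝ) : ‖expRem x‖ ≤ 2 * |x| := by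
  have hexp : ‖Complex.exp (x * Complex.I) - 1‖ ≤ |x| := by
    simpa only [mul_comm, Real.norm_eq_abs] using Real.norm_exp_I_mul_ofReal_sub_one_le (x := x)
  have hlin : ‖(x : ℂ) * Complex.I‖ = |x| := by simp
  exact (norm_sub_le _ _).trans (by linarith)

lemma norm_expRem_le_sq (x : ℝ) : ‖expRem x‖ ≤ 2 * x ^ 2 := by
  have hlin : ‖(x : ℂ) * Complex.I‖ = |x| := by simp
  rcases le_total |x| 1 with hx | hx
  · have hrem : ‖expRem x‖ ≤ x ^ 2 := by
      simpa only [expRem, hlin, sq_abs] using Complex.norm_exp_sub_one_sub_id_le (hlin.trans_le hx)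
    linarith [sq_nonneg x]
  · refine (norm_expRem_le x).trans ?_
    rw [← sq_abs]
    nlinarith

lemma charFun_sub_one_eq_integral_expRem {μ : Measure ℝ} [IsProbabilityMeasure μ]
    (hi : Integrable (fun x => x) μ) (h0 : ∫ x, x ∂μ = 0) (t : ℝ) :
    charFun μ t - 1 = ∫ x, expRem (t * x) ∂μ := by
  have hexp : Integrable (fun x : ℝ => Complex.exp ((t * x : ℝ) * Complex.I)) μ :=
    .of_bound (C := 1) (by fun_prop)
      (ae_of_all _ fun x => (Complex.norm_exp_ofReal_mul_I _).le)
  have hlin : Integrable (fun x : ℝ => ((t * x : ℝ) : ℂ) * Complex.I) μ :=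
    (hi.const_mul t).ofReal.mul_const _
  have hlin0 : ∫ x : ℝ, ((t * x : ℝ) : ℂ) * Complex.I ∂μ = 0 := by
    rw [integral_mul_const, integral_complex_ofReal, integral_const_mul, h0]
    simp
  simp only [expRem]
  rw [integral_sub (f := fun x : ℝ => Complex.exp ((t * x : ℝ) * Complex.I) - 1)
    (hexp.sub (integrable_const _)) hlin, hlin0, integral_sub hexp (integrable_const _),
    charFun_apply_real]
  simp

end CharFunRemainder

section CentredPareto

variable {α : ℝ}

/-- The Lévy exponent at `1` of the centred stable law with Lévy measure `α u ^ (-(α + 1)) du` on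
`(0, ∞)`, which attracts the sums of independent centred Pareto variables. -/
noncomputable def stableExponent (α : ℝ) : ℂ :=
  ∫ u in Set.Ioi (0 : ℝ), (α * u ^ (-(α + 1))) • expRem u

lemma norm_rpow_smul_expRem_le (hα : 0 ≤ α) {A u x : ℝ} (hA : 1 ≤ A) (hu : 0 < u)
    (hx : |x| ≤ A * u) :
    ‖(α * u ^ (-(α + 1))) • expRem x‖ ≤ 2 * α * A ^ 2 * min (u ^ (1 - α)) (u ^ (-α)) := by
  have hsq : u ^ (-(α + 1)) * u ^ 2 = u ^ (1 - α) := by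
    rw [sq, ← mul_assoc, rpow_neg_add_one_mul_self hu, ← Real.rpow_add_one hu.ne', neg_add_eq_sub]
  have hbound : ‖expRem x‖ ≤ 2 * A ^ 2 * min (u ^ 2) u := by
    rw [mul_min_of_nonneg _ _ (by positivity)]
    refine le_min ((norm_expRem_le_sq x).trans ?_) ((norm_expRem_le x).trans ?_)
    · have hx2 := pow_le_pow_left₀ (abs_nonneg x) hx 2
      rw [sq_abs] at hx2
      linarith
    · have hAu : A * u ≤ A ^ 2 * u := by
        gcongr
        exact le_self_pow₀ hA two_ne_zero
      linarith
  rw [norm_smul, Real.norm_of_nonneg (by positivity), ← hsq, ← rpow_neg_add_one_mul_self hu α,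
    ← mul_min_of_nonneg _ _ (by positivity)]
  calc α * u ^ (-(α + 1)) * ‖expRem x‖
      ≤ α * u ^ (-(α + 1)) * (2 * A ^ 2 * min (u ^ 2) u) := by gcongr
    _ = 2 * α * A ^ 2 * (u ^ (-(α + 1)) * min (u ^ 2) u) := by ring

lemma integrableOn_rpow_smul_expRem (h1 : 1 < α) (h2 : α < 2) :
    IntegrableOn (fun u : ℝ => (α * u ^ (-(α + 1))) • expRem u) (Set.Ioi 0) := by
  refine ((integrableOn_Ioi_min_rpow (a := 1 - α) (b := -α) (by linarith) (by linarith)).const_mul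
    (2 * α * 1 ^ 2)).mono' (Measurable.aestronglyMeasurable (by fun_prop)) ?_
  filter_upwards [ae_restrict_mem measurableSet_Ioi] with u hu
  have hu0 : 0 < u := hu
  exact norm_rpow_smul_expRem_le (by linarith) le_rfl hu0 (by rw [one_mul, abs_of_pos hu0])

lemma re_stableExponent_neg (h1 : 1 < α) (h2 : α < 2) : (stableExponent α).re < 0 := by
  have hint := integrableOn_rpow_smul_expRem h1 h2
  have hre (u : ℝ) : (-(α * u ^ (-(α + 1))) • expRem u).re =
      α * u ^ (-(α + 1)) * (1 - Real.cos u) := by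
    rw [Complex.real_smul, Complex.re_ofReal_mul, re_expRem]
    ring
  have hpos : 0 < ∫ u in Set.Ioi (0 : ℝ), (-(α * u ^ (-(α + 1))) • expRem u).re := by
    refine setIntegral_Ioi_pos ?_ (fun u hu => ?_) fun u hu hu1 => ?_
    · simp only [neg_smul]
      exact hint.neg.re
    · rw [hre]
      exact mul_nonneg (by positivity) (sub_nonneg.2 (Real.cos_le_one u))
    · have hcos : Real.cos u < Real.cos 0 :=
        Real.cos_lt_cos_of_nonneg_of_le_pi le_rfl (by linarith [Real.pi_gt_three]) hu
      rw [Real.cos_zero] at hcos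
      rw [hre]
      exact mul_pos (by positivity) (sub_pos.2 hcos)
  have hneg : ∫ u in Set.Ioi (0 : ℝ), (-(α * u ^ (-(α + 1))) • expRem u).re =
      -(stableExponent α).re := by
    simp only [neg_smul]
    rw [← Complex.neg_re, stableExponent, ← integral_neg]
    exact integral_re hint.neg
  linarith

lemma abs_sub_mul_le {t u : ℝ} (ht : 0 ≤ t) (htu : t ≤ u) (m : ℝ) :
    |u - t * m| ≤ (1 + |m|) * u := by
  calc |u - t * m| ≤ |u| + |t * m| := abs_sub _ _
    _ = u + t * |m| := by rw [abs_of_nonneg (ht.trans htu), abs_mul, abs_of_nonneg ht]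
    _ ≤ u + u * |m| := by gcongr
    _ = (1 + |m|) * u := by ring

lemma tendsto_integral_rpow_smul_expRem (h1 : 1 < α) (h2 : α < 2) (m : ℝ) :
    Tendsto (fun t : ℝ => ∫ u in Set.Ioi t, (α * u ^ (-(α + 1))) • expRem (u - t * m)) (𝓝[>] 0)
      (𝓝 (stableExponent α)) := by
  have hind : (fun t : ℝ => ∫ u in Set.Ioi (0 : ℝ), (Set.Ioi t).indicator
        (fun u => (α * u ^ (-(α + 1))) • expRem (u - t * m)) u) =ᶠ[𝓝[>] 0]
      fun t => ∫ u in Set.Ioi t, (α * u ^ (-(α + 1))) • expRem (u - t * m) := by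
    filter_upwards [self_mem_nhdsWithin] with t ht
    rw [setIntegral_indicator measurableSet_Ioi,
      Set.inter_eq_right.2 (Set.Ioi_subset_Ioi (le_of_lt ht))]
  refine (tendsto_integral_filter_of_dominated_convergence
    (fun u => 2 * α * (1 + |m|) ^ 2 * min (u ^ (1 - α)) (u ^ (-α)))
    (.of_forall fun t => ?_) ?_ ((integrableOn_Ioi_min_rpow (by linarith)
      (by linarith)).const_mul _) ?_).congr' hind
  · exact (Measurable.indicator (by fun_prop) measurableSet_Ioi).aestronglyMeasurable
  · filter_upwards [self_mem_nhdsWithin] with t ht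
    filter_upwards [ae_restrict_mem measurableSet_Ioi] with u hu
    have hu0 : 0 < u := hu
    by_cases htu : u ∈ Set.Ioi t
    · rw [Set.indicator_of_mem htu]
      exact norm_rpow_smul_expRem_le (by linarith) (by linarith [abs_nonneg m]) hu0
        (abs_sub_mul_le (le_of_lt ht) (le_of_lt htu) m)
    · rw [Set.indicator_of_notMem htu, norm_zero]
      positivity
  · filter_upwards [ae_restrict_mem measurableSet_Ioi] with u hu
    have hcont : Continuous fun t : ℝ => (α * u ^ (-(α + 1))) • expRem (u - t * m) := by fun_prop
    have hlim : Tendsto (fun t : ℝ => (α * u ^ (-(α + 1))) • expRem (u - t * m)) (𝓝[>] 0)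
        (𝓝 ((α * u ^ (-(α + 1))) • expRem u)) := by
      simpa using (hcont.tendsto 0).mono_left nhdsWithin_le_nhds
    refine hlim.congr' ?_
    filter_upwards [mem_nhdsWithin_of_mem_nhds (Iio_mem_nhds hu)] with t ht
    have hut : u ∈ Set.Ioi t := ht
    rw [Set.indicator_of_mem hut]

/-- The law of `Y - 𝔼 Y` for a Pareto variable `Y` with scale `1` and shape `α`. -/
noncomputable def centredPareto (α : ℝ) : Measure ℝ :=
  (paretoMeasure 1 α).map fun y => y - ∫ x, x ∂paretoMeasure 1 α

lemma isProbabilityMeasure_centredPareto (hα : 0 < α) :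
    IsProbabilityMeasure (centredPareto α) := by
  have := isProbabilityMeasure_paretoMeasure one_pos hα
  exact Measure.isProbabilityMeasure_map (by fun_prop)

lemma integrable_id_centredPareto (h1 : 1 < α) : Integrable (fun x => x) (centredPareto α) := by
  have := isProbabilityMeasure_paretoMeasure one_pos (one_pos.trans h1)
  exact (integrable_map_measure (by fun_prop) (by fun_prop)).2
    ((integrable_id_paretoMeasure one_pos h1).sub (integrable_const _))

lemma integral_id_centredPareto (h1 : 1 < α) : ∫ x, x ∂centredPareto α = 0 := by
  have := isProbabilityMeasure_paretoMeasure one_pos (one_pos.trans h1)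
  rw [centredPareto, integral_map (by fun_prop) (by fun_prop),
    integral_sub (integrable_id_paretoMeasure one_pos h1) (integrable_const _)]
  simp

lemma ae_centredPareto_ge (α : ℝ) :
    ∀ᵐ x ∂centredPareto α, -(∫ y, y ∂paretoMeasure 1 α) ≤ x := by
  refine (ae_map_iff (by fun_prop) measurableSet_Ici).2 ?_
  filter_upwards [ae_paretoMeasure_lt 1 α] with y hy
  linarith

lemma charFun_centredPareto_sub_one (h1 : 1 < α) {t : ℝ} (ht : 0 < t) :
    charFun (centredPareto α) t - 1 = (t ^ α) • ∫ u in Set.Ioi t,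
      (α * u ^ (-(α + 1))) • expRem (u - t * ∫ y, y ∂paretoMeasure 1 α) := by
  have hα : 0 < α := one_pos.trans h1
  have := isProbabilityMeasure_centredPareto hα
  set m := ∫ y, y ∂paretoMeasure 1 α
  calc charFun (centredPareto α) t - 1
      = ∫ x, expRem (t * x) ∂centredPareto α :=
        charFun_sub_one_eq_integral_expRem (integrable_id_centredPareto h1)
          (integral_id_centredPareto h1) t
    _ = ∫ y, expRem (t * (y - m)) ∂paretoMeasure 1 α :=
        integral_map (by fun_prop) (by fun_prop)
    _ = ∫ u, expRem (u - t * m) ∂paretoMeasure t α := by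
        have hmap := map_const_mul_paretoMeasure ht one_pos hα
        rw [mul_one] at hmap
        rw [← hmap, integral_map (by fun_prop) (by fun_prop)]
        simp only [mul_sub]
    _ = (t ^ α) • ∫ u in Set.Ioi t, (α * u ^ (-(α + 1))) • expRem (u - t * m) := by
        rw [integral_paretoMeasure ht hα, ← integral_smul]
        simp only [smul_smul, mul_assoc, mul_left_comm]

lemma tendsto_charFun_centredPareto (h1 : 1 < α) (h2 : α < 2) :
    Tendsto (fun t : ℝ => (t ^ α)⁻¹ • (charFun (centredPareto α) t - 1)) (𝓝[>] 0)
      (𝓝 (stableExponent α)) := by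
  refine (tendsto_integral_rpow_smul_expRem h1 h2 (∫ y, y ∂paretoMeasure 1 α)).congr' ?_
  filter_upwards [self_mem_nhdsWithin] with t ht
  have ht0 : 0 < t := ht
  rw [charFun_centredPareto_sub_one h1 ht0, inv_smul_smul₀ (by positivity)]

end CentredPareto

lemma isIIDSeq_infinitePi (μ : Measure ℝ) [IsProbabilityMeasure μ] :
    IsIIDSeq (Measure.infinitePi fun _ : ℕ => μ) fun i ω => ω i where
  measurable i := measurable_pi_apply i
  indep := iIndepFun_infinitePi (X := fun _ x => x) fun _ => measurable_id
  identDistrib i := ⟨(measurable_pi_apply i).aemeasurable, (measurable_pi_apply 0).aemeasurable,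
    (Measure.infinitePi_map_eval (fun _ => μ) i).trans
      (Measure.infinitePi_map_eval (fun _ => μ) 0).symm⟩

section ParetoSums

variable {Ω : Type*} [MeasurableSpace Ω] {P : Measure Ω} {X Y : ℕ → Ω → ℝ} {α : ℝ}

lemma map_eq_paretoMeasure [IsProbabilityMeasure P] {Z : Ω → ℝ} (hZ : Measurable Z) (hα : 0 < α)
    (htail : ∀ y : ℝ, 1 ≤ y → P.real {ω | y < Z ω} = y ^ (-α)) :
    P.map Z = paretoMeasure 1 α := by
  have := Measure.isProbabilityMeasure_map (μ := P) hZ.aemeasurable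
  refine eq_paretoMeasure one_pos hα fun y hy => ?_
  have hy0 : 0 ≤ y := zero_le_one.trans hy
  rw [map_measureReal_apply hZ measurableSet_Ioi, one_div, Real.inv_rpow hy0, ← Real.rpow_neg hy0,
    ← htail y hy]
  rfl

lemma integrable_of_paretoMeasure {Z : Ω → ℝ} (hZ : Measurable Z) (h1 : 1 < α)
    (hlaw : P.map Z = paretoMeasure 1 α) : Integrable Z P :=
  (integrable_map_measure (g := fun y => y) (by fun_prop) hZ.aemeasurable).1
    (hlaw ▸ integrable_id_paretoMeasure one_pos h1)

lemma map_sub_integral_eq_centredPareto {Z : Ω → ℝ} (hZ : Measurable Z)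
    (hlaw : P.map Z = paretoMeasure 1 α) :
    P.map (fun ω => Z ω - ∫ ω', Z ω' ∂P) = centredPareto α := by
  have hmean : ∫ ω, Z ω ∂P = ∫ y, y ∂paretoMeasure 1 α := by
    rw [← hlaw, integral_map hZ.aemeasurable (by fun_prop)]
  rw [hmean, centredPareto, ← hlaw, Measure.map_map (by fun_prop) hZ]
  rfl

namespace IsIIDSeq

lemma comp (h : IsIIDSeq P X) {f : ℝ → ℝ} (hf : Measurable f) : IsIIDSeq P fun i ω => f (X i ω) :=
  ⟨fun i => hf.comp (h.measurable i), h.indep.comp (fun _ => f) fun _ => hf,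
    fun i => (h.identDistrib i).comp hf⟩

lemma integrable_of_centredPareto (h : IsIIDSeq P X) (h1 : 1 < α)
    (hX : P.map (X 0) = centredPareto α) : Integrable (X 0) P :=
  (integrable_map_measure (g := fun x => x) (by fun_prop) (h.measurable 0).aemeasurable).1
    (hX ▸ integrable_id_centredPareto h1)

lemma integral_of_centredPareto (h : IsIIDSeq P X) (h1 : 1 < α)
    (hX : P.map (X 0) = centredPareto α) : ∫ ω, X 0 ω ∂P = 0 := by
  rw [← integral_id_centredPareto h1, ← hX,
    integral_map (h.measurable 0).aemeasurable (by fun_prop)]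

variable [IsProbabilityMeasure P]

lemma tendsto_integral_abs_partialSum_of_centredPareto (h : IsIIDSeq P X) (h1 : 1 < α) (h2 : α < 2)
    (hX : P.map (X 0) = centredPareto α) :
    Tendsto (fun n : ℕ => (n : ℝ) ^ (-(1 / α)) * ∫ ω, |partialSum X n ω| ∂P) atTop
      (𝓝 (stableAbsMoment α (stableExponent α))) :=
  h.tendsto_integral_abs_partialSum (h.integrable_of_centredPareto h1 hX) h1
    (hX ▸ tendsto_charFun_centredPareto h1 h2)

lemma sameOrder_integral_abs_partialSum_of_centredPareto (h : IsIIDSeq P X) (h1 : 1 < α)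
    (h2 : α < 2) (hX : P.map (X 0) = centredPareto α) :
    SameOrder (fun n => ∫ ω, |partialSum X n ω| ∂P) fun n => (n : ℝ) ^ (1 / α) :=
  h.sameOrder_integral_abs_partialSum (h.integrable_of_centredPareto h1 hX)
    (h.integral_of_centredPareto h1 hX)
    (stableAbsMoment_pos h1 (re_stableExponent_neg h1 h2)).ne'
    (h.tendsto_integral_abs_partialSum_of_centredPareto h1 h2 hX)

theorem sameOrder_persistenceProb_of_centredPareto (h : IsIIDSeq P X) (h1 : 1 < α)
    (h2 : α < 2) (hX : P.map (X 0) = centredPareto α) :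
    SameOrder (persistenceProb P X) fun n => (n : ℝ) ^ (-((1 - 1 / α) / 2)) := by
  have hα : 0 < α := one_pos.trans h1
  have hbdd : ∀ᵐ ω ∂P, -(∫ y, y ∂paretoMeasure 1 α) ≤ X 0 ω :=
    ae_of_ae_map (h.measurable 0).aemeasurable (hX ▸ ae_centredPareto_ge α)
  exact h.sameOrder_persistenceProb (h.integrable_of_centredPareto h1 hX)
    (h.integral_of_centredPareto h1 hX) hbdd (by positivity) ((div_le_one hα).2 h1.le)
    (h.sameOrder_integral_abs_partialSum_of_centredPareto h1 h2 hX)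

end IsIIDSeq

end ParetoSums

theorem mainTheorem3 :
    -- every exponent in `(0, 1/4)` occurs
    (∀ γ : ℝ, 0 < γ → γ < 1 / 4 →
      ∃ (Ω : Type) (_ : MeasurableSpace Ω) (P : Measure Ω) (X : ℕ → Ω → ℝ),
        IsProbabilityMeasure P ∧ IsIIDSeq P X ∧
        Integrable (X 0) P ∧ ∫ ω, X 0 ω ∂P = 0 ∧
        SameOrder (fun n => persistenceProb P X n) (fun n => (n : ℝ) ^ (-γ))) ∧
    -- the explicit example of centred Pareto variables
    (∀ α : ℝ, 1 < α → α < 2 →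
      ∀ (Ω : Type*) (_ : MeasurableSpace Ω) (P : Measure Ω) (Y : ℕ → Ω → ℝ),
        IsProbabilityMeasure P → IsIIDSeq P Y →
        (∀ y : ℝ, 1 ≤ y → P.real {ω | y < Y 0 ω} = y ^ (-α)) →
        ∀ X : ℕ → Ω → ℝ, (∀ i ω, X i ω = Y i ω - ∫ ω', Y 0 ω' ∂P) →
          Integrable (Y 0) P ∧ Integrable (X 0) P ∧ ∫ ω, X 0 ω ∂P = 0 ∧
          (∃ L : ℝ, 0 < L ∧
            Tendsto (fun n : ℕ => (n : ℝ) ^ (-(1 / α)) * ∫ ω, |partialSum X n ω| ∂P)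
              atTop (𝓝 L)) ∧
          SameOrder (fun n => ∫ ω, |partialSum X n ω| ∂P) (fun n => (n : ℝ) ^ (1 / α)) ∧
          SameOrder (fun n => persistenceProb P X n)
            (fun n => (n : ℝ) ^ (-((1 - 1 / α) / 2)))) := by
  refine ⟨fun γ hγ hγ' => ?_, fun α h1 h2 Ω _ P Y _ h htail X hX => ?_⟩
  · obtain ⟨α, rfl⟩ : ∃ α : ℝ, γ = (1 - 1 / α) / 2 :=
      ⟨1 / (1 - 2 * γ), by rw [one_div_one_div]; ring⟩
    have hα : 0 < α := one_div_pos.1 (by linarith)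
    have h1 : 1 < α := (div_lt_one hα).1 (by linarith)
    have h2 : α < 2 := lt_of_one_div_lt_one_div two_pos (by linarith)
    have := isProbabilityMeasure_centredPareto hα
    have h := isIIDSeq_infinitePi (centredPareto α)
    have hlaw := Measure.infinitePi_map_eval (fun _ : ℕ => centredPareto α) 0
    exact ⟨ℕ → ℝ, _, _, _, inferInstance, h, h.integrable_of_centredPareto h1 hlaw,
      h.integral_of_centredPareto h1 hlaw, h.sameOrder_persistenceProb_of_centredPareto h1 h2 hlaw⟩
  · have hY := map_eq_paretoMeasure (h.measurable 0) (one_pos.trans h1) htail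
    obtain rfl : X = fun i ω => Y i ω - ∫ ω', Y 0 ω' ∂P := funext₂ hX
    have hiid := h.comp (measurable_id.sub_const (∫ ω', Y 0 ω' ∂P))
    have hlaw := map_sub_integral_eq_centredPareto (h.measurable 0) hY
    exact ⟨integrable_of_paretoMeasure (h.measurable 0) h1 hY,
      hiid.integrable_of_centredPareto h1 hlaw, hiid.integral_of_centredPareto h1 hlaw,
      ⟨_, stableAbsMoment_pos h1 (re_stableExponent_neg h1 h2),
        hiid.tendsto_integral_abs_partialSum_of_centredPareto h1 h2 hlaw⟩,
      hiid.sameOrder_integral_abs_partialSum_of_centredPareto h1 h2 hlaw,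
      hiid.sameOrder_persistenceProb_of_centredPareto h1 h2 hlaw⟩
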